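/- For $h\ge 1$ let $U_h$ denote the closed nonorientable surface of nonorientable genus $h$, that is, the connected sum $\mathbb{RP}^2\#\cdots\#\mathbb{RP}^2$ of $h$ copies of the real projective plane. For every even integer $h\ge 4$, the surface $U_h$ embeds smoothly in the $3$-torus $T^3=S^1\times S^1\times S^1$: there are a smooth structure on $U_h$ (compatible with its topology) and a smooth embedding $U_h\to T^3$, that is, a map that is both a smooth immersion and a homeomorphism onto its image. -/

import Mathlib

open scoped Manifold ContDiff LinearAlgebra.Projectivization

noncomputable section

/-- The real projective plane: lines through the origin of `ℝ³`. -/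
def ProjectivePlane : Type := ℙ ℝ (Fin 3 → ℝ)

/-- The quotient topology induced by the projection `ℝ³ ∖ {0} → ℝP²`. -/
instance : TopologicalSpace ProjectivePlane :=
  TopologicalSpace.coinduced
    (fun v : {v : Fin 3 → ℝ // v ≠ 0} => (Projectivization.mk ℝ v.1 v.2 : ProjectivePlane))
    inferInstance

/-- The affine chart `z ↦ [Re z : Im z : 2]` of the projective plane. It embeds the closed unit disc
of the complex plane as a closed disc around `[0 : 0 : 1]`. -/
def ProjectivePlane.discA (z : ℂ) : ProjectivePlane :=
  Projectivization.mk ℝ ![z.re, z.im, 2] fun h0 => by simpa using congrFun h0 2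

/-- The affine chart `z ↦ [2 : Re z : Im z]` of the projective plane. It embeds the closed unit disc
of the complex plane as a closed disc around `[1 : 0 : 0]`, disjoint from the closed disc given by
`ProjectivePlane.discA`. -/
def ProjectivePlane.discB (z : ℂ) : ProjectivePlane :=
  Projectivization.mk ℝ ![2, z.re, z.im] fun h0 => by simpa using congrFun h0 0

open ProjectivePlane in
/-- The disjoint union of `h` copies of the projective plane, numbered `0, …, h - 1`, with open discs
removed: the open disc `A` from every copy but the first, and the open disc `B` from every copy but
the last. -/
def PuncturedProjectivePlanes (h : ℕ) : Type :=
  {p : Fin h × ProjectivePlane //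
    (0 < (p.1 : ℕ) → p.2 ∉ discA '' Metric.ball 0 1) ∧
    ((p.1 : ℕ) + 1 < h → p.2 ∉ discB '' Metric.ball 0 1)}

instance (h : ℕ) : TopologicalSpace (PuncturedProjectivePlanes h) :=
  instTopologicalSpaceSubtype

/-- The gluing of boundary circles: for `|z| = 1`, the boundary point with parameter `z` of the
disc `B` in the copy number `i` is glued to the boundary point with parameter `z` of the disc `A` in
the copy number `i + 1`. -/
def PuncturedProjectivePlanes.Glue {h : ℕ} (p q : PuncturedProjectivePlanes h) : Prop :=
  (q.1.1 : ℕ) = (p.1.1 : ℕ) + 1 ∧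
    ∃ z : ℂ, ‖z‖ = 1 ∧ p.1.2 = ProjectivePlane.discB z ∧ q.1.2 = ProjectivePlane.discA z

/-- The closed nonorientable surface `U_h` of nonorientable genus `h`: the connected sum
`ℝP² # ⋯ # ℝP²` of `h` copies of the projective plane (for `h ≥ 1`), each copy being summed to the
next one along a disc. `Quot` divides by the equivalence relation generated by the gluing, and
carries the quotient topology. -/
def NonorientableSurface (h : ℕ) : Type :=
  Quot (PuncturedProjectivePlanes.Glue (h := h))

instance (h : ℕ) : TopologicalSpace (NonorientableSurface h) :=
  inferInstanceAs (TopologicalSpace (Quot (PuncturedProjectivePlanes.Glue (h := h))))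

/-- The three-dimensional torus `T³ = S¹ × S¹ × S¹`, with the product topology and the product smooth
structure; its model with corners is `(𝓡 1).prod ((𝓡 1).prod (𝓡 1))`. -/
abbrev ThreeTorus : Type := Circle × Circle × Circle

end

/-!
The connected sum with `ℝP²` is a blow-up, so that `U_h` is the projective plane blown up at `h - 1`
points. Let these be `O = [0 : 0 : 1]` and `m = h - 2` points `p_0, …, p_{m - 1}` of a line that does
not contain `O`. The blow-up at `O` is a circle bundle over the circle `ℝP¹` of directions `S` at `O`,
with fiber coordinate `[z₀ : z₁]` at the point `[z₀ S : z₁]`. As `m` is even, the points `p_i` can be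
divided into two sets `I` and `J` of odd cardinality. Let `r_I` be the product of the linear forms
that vanish on the directions of the points in `I`, and let `q_I` be a positive form of the even
degree `|I| - 1`. The ratio `[z₁ q_I(S) : z₀ r_I(S)]` is a map of the plane to `ℝP¹`, undetermined
exactly at the points in `I`, and it becomes determined when these are blown up. The direction `S`
and the ratios for `I` and `J` together map the blow-up to `T³ = ℝP¹ × ℝP¹ × ℝP¹`. The image
`blowSurface I J` is where two linear equations for `[z₀ : z₁]` have a common solution, that is, where
a determinant vanishes (`mem_blowSurface_iff`). The zeros of `r_I` and `r_J` being simple and distinct,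
this equation is regular (`exists_curve_deriv_ne_zero`), and `blowSurface I J` is a smooth surface in
the torus. Hence it suffices to find a homeomorphism of `U_h` with this subset of the torus
(`exists_smooth_structure_of_range_eq`); the smooth structure of `U_h` is transported from there.

The homeomorphism is the union of maps of the `h` copies of `ℝP²` (`chainMap`). The copy `0` covers
the part over the disc `A` about `O`, by inversion, and the copy `1` the part over the complement of
the discs `A` and `B`. The points `p_i` are in the disc `B`, which in its affine chart is the unit
disc. The affine maps `nestMap n` carry the unit disc to nested discs, the `n`-th of which is centered
at `p_n` and contains `p_i` for all `i ≥ n`. The copy `n + 2` covers the blow-up at `p_n` of the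
`n`-th disc without the next one: the map `contraction` identifies the complement of the disc `A` in
`ℝP²` with the blow-up of the unit disc at `0`, and the disc `B` with the disc `nestMap 1`. The
remaining mismatch of the parametrizations of the boundary circles consists of Möbius
transformations of the circle, which are isotopic to the identity and are absorbed into a collar
(`exists_collar_twist`). The resulting map is continuous (`continuous_surfaceMap`), injective
(`injective_surfaceMap`) and has the image `blowSurface I J` (`range_surfaceMap`); since `U_h` is
compact, it is an embedding.
-/

open scoped Manifold ContDiff LinearAlgebra.Projectivization
open Set Topology ComplexConjugate

/-! ### Submanifolds of codimension one -/

/-- The inverse function theorem, with the inverse smooth on all of its domain: the neighborhood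
is shrunk to where the derivative stays invertible. -/
theorem ContDiffOn.exists_openPartialHomeomorph {E F : Type*} [NormedAddCommGroup E]
    [NormedSpace ℝ E] [CompleteSpace E] [NormedAddCommGroup F] [NormedSpace ℝ F]
    {V : Set E} (hV : IsOpen V) {g : E → F} (hg : ContDiffOn ℝ ∞ g V) {a : E} (ha : a ∈ V)
    (g' : E ≃L[ℝ] F) (hg' : HasFDerivAt g (g' : E →L[ℝ] F) a) :
    ∃ Ξ : OpenPartialHomeomorph E F, a ∈ Ξ.source ∧ Ξ.source ⊆ V ∧ (Ξ : E → F) = g ∧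
      ContDiffOn ℝ ∞ Ξ.symm Ξ.target := by
  have hn : (∞ : WithTop ℕ∞) ≠ 0 := by simp
  have hga : ContDiffAt ℝ ∞ g a := hg.contDiffAt (hV.mem_nhds ha)
  -- on `W` the derivative is invertible
  set W : Set E := V ∩ fderiv ℝ g ⁻¹' (range ((↑) : (E ≃L[ℝ] F) → E →L[ℝ] F)) with hW
  have hWo : IsOpen W :=
    (hg.continuousOn_fderiv_of_isOpen hV (by simp)).isOpen_inter_preimage hV
      ContinuousLinearEquiv.isOpen
  set h0 := hga.toOpenPartialHomeomorph g hg' hn with hh0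
  refine ⟨h0.restrOpen W hWo, ⟨hga.mem_toOpenPartialHomeomorph_source hg' hn, ha, g',
    hg'.fderiv.symm⟩, fun x hx => hx.2.1, rfl, ?_⟩
  intro y hy
  have hys : h0.symm y ∈ h0.source ∩ W := (h0.restrOpen W hWo).map_target hy
  obtain ⟨e, he⟩ := hys.2.2
  have hxd : ContDiffAt ℝ ∞ g (h0.symm y) := hg.contDiffAt (hV.mem_nhds hys.2.1)
  have : ContDiffAt ℝ ∞ h0.symm y := by
    refine h0.contDiffAt_symm (f₀' := e) hy.1 ?_ hxd
    rw [he]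
    exact (hxd.differentiableAt (by simp)).hasFDerivAt
  exact this.contDiffWithinAt

section Slice

variable {E' G N : Type*} [NormedAddCommGroup E'] [NormedSpace ℝ E'] [FiniteDimensional ℝ E']
  [TopologicalSpace G] (J : ModelWithCorners ℝ E' G) [J.Boundaryless]
  [TopologicalSpace N] [ChartedSpace G N] [IsManifold J ∞ N]

/-- If the derivative of `F` along some curve through a point of a `3`-manifold is not zero, then
near that point `F` is the last coordinate of a chart. -/
theorem exists_straightening_chart (hdim : Module.finrank ℝ E' = 3) {F : N → ℝ}
    (hF : ContMDiff J 𝓘(ℝ, ℝ) ∞ F) {c : ℝ → N} (hc : MDifferentiableAt 𝓘(ℝ, ℝ) J c 0)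
    (hd : deriv (F ∘ c) 0 ≠ 0) :
    ∃ e : OpenPartialHomeomorph N (EuclideanSpace ℝ (Fin 2) × ℝ), c 0 ∈ e.source ∧
      ContMDiffOn J 𝓘(ℝ, EuclideanSpace ℝ (Fin 2) × ℝ) ∞ e e.source ∧
      ContMDiffOn 𝓘(ℝ, EuclideanSpace ℝ (Fin 2) × ℝ) J ∞ e.symm e.target ∧
      ∀ x ∈ e.source, (e x).2 = F x := by
  set φ : OpenPartialHomeomorph N E' := (chartAt G (c 0)).transHomeomorph J.toHomeomorph with hφ
  have hφs : φ.source = (chartAt G (c 0)).source := rfl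
  have hmem : c 0 ∈ φ.source := mem_chart_source G (c 0)
  have hφ1 : ContMDiffOn J 𝓘(ℝ, E') ∞ φ φ.source := by
    have := contMDiffOn_extChartAt (I := J) (n := ∞) (x := c 0)
    exact this
  have hφ2 : ContMDiffOn 𝓘(ℝ, E') J ∞ φ.symm φ.target := by
    refine (contMDiffOn_extChartAt_symm (I := J) (n := ∞) (c 0)).mono ?_
    intro y hy
    rw [extChartAt_target, J.range_eq_univ]
    exact ⟨hy, mem_univ _⟩
  set g : E' → ℝ := F ∘ φ.symm with hg
  have hgs : ContDiffOn ℝ ∞ g φ.target :=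
    contMDiffOn_iff_contDiffOn.1 (hF.comp_contMDiffOn hφ2)
  set a := φ (c 0) with ha
  have hat : a ∈ φ.target := φ.map_source hmem
  have hga : DifferentiableAt ℝ g a :=
    (hgs.contDiffAt (φ.open_target.mem_nhds hat)).differentiableAt (by simp)
  have hne : fderiv ℝ g a ≠ 0 := by
    intro h0
    apply hd
    have hcd : DifferentiableAt ℝ (φ ∘ c) 0 := by
      rw [← mdifferentiableAt_iff_differentiableAt]
      exact (((hφ1.contMDiffAt (φ.open_source.mem_nhds hmem)).mdifferentiableAt
        (by simp)).comp (0 : ℝ) hc)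
    have h1 : HasDerivAt (g ∘ (φ ∘ c)) (fderiv ℝ g a (deriv (φ ∘ c) 0)) 0 :=
      HasFDerivAt.comp_hasDerivAt (0 : ℝ) (by exact hga.hasFDerivAt) hcd.hasDerivAt
    rw [h0] at h1
    have h2 : F ∘ c =ᶠ[𝓝 0] g ∘ (φ ∘ c) := by
      filter_upwards [hc.continuousAt.preimage_mem_nhds (φ.open_source.mem_nhds hmem)] with t ht
      simp only [hg, Function.comp_apply]
      rw [φ.left_inv ht]
    rw [h2.deriv_eq, h1.deriv]
    rfl
  set ℓ := fderiv ℝ g a with hℓ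
  have hℓs : Function.Surjective ℓ := by
    refine LinearMap.surjective (f := (ℓ : E' →ₗ[ℝ] ℝ)) ?_
    intro h; exact hne (by ext x; exact LinearMap.congr_fun h x)
  have hker : Module.finrank ℝ (LinearMap.ker (ℓ : E' →ₗ[ℝ] ℝ)) = 2 := by
    have h1 := LinearMap.finrank_range_add_finrank_ker (ℓ : E' →ₗ[ℝ] ℝ)
    rw [LinearMap.range_eq_top.2 hℓs, finrank_top, hdim] at h1
    simp at h1; omega
  -- `ℓ` is completed to an isomorphism by a projection to its kernel
  obtain ⟨q, hq⟩ := (LinearMap.ker (ℓ : E' →ₗ[ℝ] ℝ)).exists_isCompl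
  let K := LinearMap.ker (ℓ : E' →ₗ[ℝ] ℝ)
  let k : K ≃ₗ[ℝ] EuclideanSpace ℝ (Fin 2) := LinearEquiv.ofFinrankEq _ _ (by rw [hker]; simp)
  let A : E' →ₗ[ℝ] EuclideanSpace ℝ (Fin 2) := k.toLinearMap ∘ₗ K.projectionOnto q hq
  let L0 : E' →ₗ[ℝ] EuclideanSpace ℝ (Fin 2) × ℝ := A.prod (ℓ : E' →ₗ[ℝ] ℝ)
  have hL0 : Function.Injective L0 := by
    rw [← LinearMap.ker_eq_bot, LinearMap.ker_eq_bot']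
    intro x hx
    have hx1 : A x = 0 := congrArg Prod.fst hx
    have hx2 : x ∈ K := congrArg Prod.snd hx
    have hx3 : K.projectionOnto q hq x = 0 := by
      apply k.injective; rw [map_zero]; exact hx1
    have := Submodule.projectionOnto_apply_left hq ⟨x, hx2⟩
    rw [show ((⟨x, hx2⟩ : K) : E') = x from rfl, hx3] at this
    exact (congrArg Subtype.val this).symm
  let L : E' ≃L[ℝ] EuclideanSpace ℝ (Fin 2) × ℝ :=
    (LinearEquiv.ofInjectiveOfFinrankEq L0 hL0 (by simp [hdim])).toContinuousLinearEquiv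
  let Ac : E' →L[ℝ] EuclideanSpace ℝ (Fin 2) := LinearMap.toContinuousLinearMap A
  have hΘ : HasFDerivAt (fun x => (Ac x, g x)) (L : E' →L[ℝ] _) a := by
    have := (Ac.hasFDerivAt (x := a)).prodMk hga.hasFDerivAt
    convert! this using 1
  obtain ⟨Ξ, h1, h2, h3, h4⟩ := ContDiffOn.exists_openPartialHomeomorph φ.open_target
    (Ac.contDiff.contDiffOn.prodMk hgs) hat L hΘ
  have h5 : ContDiffOn ℝ ∞ Ξ Ξ.source := by
    rw [h3]; exact (Ac.contDiff.contDiffOn.prodMk hgs).mono h2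
  refine ⟨φ.trans Ξ, ⟨hmem, h1⟩, ?_, ?_, ?_⟩
  · exact (contMDiffOn_iff_contDiffOn.2 h5).comp (hφ1.mono inter_subset_left) fun x hx => hx.2
  · exact hφ2.comp ((contMDiffOn_iff_contDiffOn.2 h4).mono inter_subset_left) fun x hx => hx.2
  · intro x hx
    have : (φ.trans Ξ) x = (Ac (φ x), g (φ x)) := by
      simp only [OpenPartialHomeomorph.coe_trans, Function.comp_apply, h3]
    rw [this]
    simp only [hg, Function.comp_apply, φ.left_inv hx.1]

end Slice

section Submanifold

variable {X N : Type*} [TopologicalSpace N] {f : X → N}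

theorem apply_invFun_slice_symm [Nonempty X] {E : Type*}
    [TopologicalSpace E] (e : OpenPartialHomeomorph N (E × ℝ))
    (he : ∀ y ∈ e.source, y ∈ range f ↔ (e y).2 = 0) {u : E} (hu : (u, (0 : ℝ)) ∈ e.target) :
    f (Function.invFun f (e.symm (u, 0))) = e.symm (u, 0) :=
  Function.invFun_eq ((he _ (e.map_target hu)).2 (by rw [e.right_inv hu]))

variable [TopologicalSpace X]

/-- The chart of `X` cut out by a chart `e` of the ambient space that straightens the image of an
embedding `f` of `X` to the slice `E × {0}`. -/
noncomputable def sliceChart [Nonempty X] (hf : IsEmbedding f) {E : Type*} [TopologicalSpace E]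
    (e : OpenPartialHomeomorph N (E × ℝ)) (he : ∀ y ∈ e.source, y ∈ range f ↔ (e y).2 = 0) :
    OpenPartialHomeomorph X E where
  toFun x := (e (f x)).1
  invFun u := Function.invFun f (e.symm (u, 0))
  source := f ⁻¹' e.source
  target := {u | (u, (0 : ℝ)) ∈ e.target}
  map_source' x hx := by
    have h : (e (f x)).2 = 0 := (he _ hx).1 (mem_range_self x)
    have : ((e (f x)).1, (0 : ℝ)) = e (f x) := by rw [← h]
    simp only [mem_ofPred_eq, this]
    exact e.map_source hx
  map_target' u hu := by
    rw [mem_preimage, apply_invFun_slice_symm e he hu]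
    exact e.map_target hu
  left_inv' x hx := by
    have h : (e (f x)).2 = 0 := (he _ hx).1 (mem_range_self x)
    have : ((e (f x)).1, (0 : ℝ)) = e (f x) := by rw [← h]
    rw [this, e.left_inv hx, Function.leftInverse_invFun hf.injective]
  right_inv' u hu := by
    rw [apply_invFun_slice_symm e he hu, e.right_inv hu]
  open_source := e.open_source.preimage hf.continuous
  open_target := e.open_target.preimage (by fun_prop)
  continuousOn_toFun :=
    continuous_fst.comp_continuousOn
      (e.continuousOn.comp hf.continuous.continuousOn fun _ h => h)
  continuousOn_invFun := by
    rw [hf.toIsInducing.continuousOn_iff]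
    refine ContinuousOn.congr (f := fun u => e.symm (u, (0 : ℝ))) ?_ fun u hu =>
      apply_invFun_slice_symm e he hu
    exact e.symm.continuousOn.comp (by fun_prop) fun u hu => hu

variable {E E' G : Type*} [NormedAddCommGroup E] [NormedSpace ℝ E]
  [NormedAddCommGroup E'] [NormedSpace ℝ E'] [TopologicalSpace G] (J : ModelWithCorners ℝ E' G)
  [ChartedSpace G N]

theorem sliceChart_compatible [Nonempty X] (hf : IsEmbedding f)
    (e e' : OpenPartialHomeomorph N (E × ℝ)) (he : ∀ y ∈ e.source, y ∈ range f ↔ (e y).2 = 0)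
    (he' : ∀ y ∈ e'.source, y ∈ range f ↔ (e' y).2 = 0)
    (h1 : ContMDiffOn 𝓘(ℝ, E × ℝ) J ∞ e.symm e.target)
    (h2 : ContMDiffOn J 𝓘(ℝ, E × ℝ) ∞ e' e'.source) :
    ContDiffOn ℝ ∞ (sliceChart hf e' he' ∘ (sliceChart hf e he).symm)
      ((sliceChart hf e he).symm.trans (sliceChart hf e' he')).source := by
  have hsub : ∀ u ∈ ((sliceChart hf e he).symm.trans (sliceChart hf e' he')).source,
      (u, (0 : ℝ)) ∈ e.target ∧ e.symm (u, 0) ∈ e'.source := by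
    intro u hu
    refine ⟨hu.1, ?_⟩
    rw [← apply_invFun_slice_symm e he hu.1]
    exact hu.2
  have h3 : ContDiffOn ℝ ∞ (fun u : E => (e' (e.symm (u, 0))).1)
      ((sliceChart hf e he).symm.trans (sliceChart hf e' he')).source := by
    refine contDiff_fst.comp_contDiffOn (contMDiffOn_iff_contDiffOn.1 ?_)
    refine h2.comp (h1.comp (t := e.target) ?_ fun u hu => (hsub u hu).1) fun u hu => (hsub u hu).2
    exact contMDiffOn_iff_contDiffOn.2
      (ContDiff.contDiffOn (by fun_prop))
  refine h3.congr fun u hu => ?_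
  change (e' (f (Function.invFun f (e.symm (u, 0))))).1 = _
  rw [apply_invFun_slice_symm e he hu.1]

/-- An embedded subset which is locally a coordinate slice of the ambient manifold is a smooth
submanifold: the charts cut out by straightening charts are smoothly compatible, and in them the
embedding is literally `u ↦ (u, 0)`. -/
theorem Topology.IsEmbedding.exists_smooth_structure [J.Boundaryless] [IsManifold J ∞ N]
    (hf : IsEmbedding f) (L : (E × ℝ) ≃L[ℝ] E')
    (h : ∀ x, ∃ e : OpenPartialHomeomorph N (E × ℝ), f x ∈ e.source ∧
      ContMDiffOn J 𝓘(ℝ, E × ℝ) ∞ e e.source ∧ ContMDiffOn 𝓘(ℝ, E × ℝ) J ∞ e.symm e.target ∧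
      ∀ y ∈ e.source, y ∈ range f ↔ (e y).2 = 0) :
    ∃ (_ : ChartedSpace E X) (_ : IsManifold 𝓘(ℝ, E) ∞ X),
      Manifold.IsSmoothEmbedding 𝓘(ℝ, E) J ∞ f := by
  choose e h1 h2 h3 h4 using h
  let d : X → OpenPartialHomeomorph X E := fun x =>
    haveI : Nonempty X := ⟨x⟩
    sliceChart hf (e x) (h4 x)
  let cs : ChartedSpace E X :=
    { atlas := range d
      chartAt := d
      mem_chart_source := h1
      chart_mem_atlas := mem_range_self }
  have hm : IsManifold 𝓘(ℝ, E) ∞ X := by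
    refine isManifold_of_contDiffOn _ _ _ ?_
    rintro _ _ ⟨x, rfl⟩ ⟨x', rfl⟩
    have : Nonempty X := ⟨x⟩
    have := sliceChart_compatible J hf (e x) (e x') (h4 x) (h4 x') (h3 x) (h2 x')
    simpa using this
  refine ⟨cs, hm, ?_, hf⟩
  refine Manifold.IsImmersionOfComplement.isImmersion (F := ℝ) fun x => ?_
  have : Nonempty X := ⟨x⟩
  let c : OpenPartialHomeomorph N G :=
    (e x).transHomeomorph (L.toHomeomorph.trans J.toHomeomorph.symm)
  have hL : ContDiff ℝ ∞ L := L.contDiff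
  have hLs : ContDiff ℝ ∞ L.symm := L.symm.contDiff
  have hJ : ContMDiff 𝓘(ℝ, E') J ∞ J.symm := by
    have := J.contMDiffOn_symm (n := ∞)
    rwa [J.range_eq_univ, contMDiffOn_univ] at this
  refine Manifold.IsImmersionAtOfComplement.mk_of_charts L (d x) c (h1 x) (h1 x)
    (StructureGroupoid.subset_maximalAtlas _ (mem_range_self x)) ?_ (fun y hy => hy) ?_
  · refine c.mem_maximalAtlas_of_contMDiffOn ?_ ?_
    · exact hJ.comp_contMDiffOn (hL.contMDiff.comp_contMDiffOn (h2 x))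
    · refine (h3 x).comp (t := (e x).target) ?_ fun y hy => hy
      exact (hLs.contMDiff.comp J.contMDiff).contMDiffOn
  · intro u hu
    have hu' : (u, (0 : ℝ)) ∈ (e x).target := by
      have : u ∈ (d x).target := by simpa using hu
      exact this
    change J (J.symm (L (e x (f (Function.invFun f ((e x).symm (u, 0))))))) = L (u, 0)
    rw [apply_invFun_slice_symm (e x) (h4 x) hu', (e x).right_inv hu',
      J.right_inv (by rw [J.range_eq_univ]; exact mem_univ _)]

end Submanifold

/-! ### Homogeneous coordinates and the discs of the projective plane -/

namespace ProjectivePlane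

/-- The point `[v 0 : v 1 : v 2]` of the projective plane. -/
noncomputable def mk (v : Fin 3 → ℝ) (hv : v ≠ 0) : ProjectivePlane := Projectivization.mk ℝ v hv

/-- A choice of homogeneous coordinates of a point. -/
noncomputable def coords (p : ProjectivePlane) : Fin 3 → ℝ :=
  Projectivization.rep (K := ℝ) (V := Fin 3 → ℝ) p

theorem coords_ne_zero (p : ProjectivePlane) : coords p ≠ 0 := Projectivization.rep_nonzero _

@[simp] theorem mk_coords (p : ProjectivePlane) : mk (coords p) (coords_ne_zero p) = p :=
  Projectivization.mk_rep _

theorem mk_eq_mk_iff {v w : Fin 3 → ℝ} {hv : v ≠ 0} {hw : w ≠ 0} :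
    mk v hv = mk w hw ↔ ∃ a : ℝ, a ≠ 0 ∧ w = a • v := by
  constructor
  · intro h
    obtain ⟨a, ha⟩ := (Projectivization.mk_eq_mk_iff ℝ w v hw hv).1 h.symm
    exact ⟨a, a.ne_zero, ha.symm⟩
  · rintro ⟨a, ha, rfl⟩
    exact ((Projectivization.mk_eq_mk_iff ℝ (a • v) v hw hv).2 ⟨Units.mk0 a ha, rfl⟩).symm

theorem exists_coords_mk (v : Fin 3 → ℝ) (hv : v ≠ 0) :
    ∃ a : ℝ, a ≠ 0 ∧ coords (mk v hv) = a • v := by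
  rw [← mk_eq_mk_iff (hv := hv) (hw := coords_ne_zero _), mk_coords]

theorem isOpenQuotientMap_mk :
    IsOpenQuotientMap (fun v : {v : Fin 3 → ℝ // v ≠ 0} => mk v.1 v.2) := by
  refine ⟨fun p => ⟨⟨coords p, coords_ne_zero p⟩, mk_coords p⟩, continuous_coinduced_rng, ?_⟩
  intro U hU
  obtain ⟨V, hV, rfl⟩ := isOpen_induced_iff.1 hU
  have : (fun v : {v : Fin 3 → ℝ // v ≠ 0} => mk v.1 v.2) ⁻¹'
      ((fun v : {v : Fin 3 → ℝ // v ≠ 0} => mk v.1 v.2) '' (Subtype.val ⁻¹' V)) =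
      ⋃ a : {a : ℝ // a ≠ 0}, (fun v : {v : Fin 3 → ℝ // v ≠ 0} => a.1 • v.1) ⁻¹' V := by
    ext v
    simp only [mem_preimage, mem_image, mem_iUnion, Subtype.exists]
    constructor
    · rintro ⟨w, hw, hwV, h⟩
      obtain ⟨a, ha, rfl⟩ := mk_eq_mk_iff.1 h.symm
      exact ⟨a, ha, hwV⟩
    · rintro ⟨a, ha, h⟩
      exact ⟨a • v.1, smul_ne_zero ha v.2, h, (mk_eq_mk_iff.2 ⟨a, ha, rfl⟩).symm⟩
  refine isOpen_coinduced.2 ?_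
  refine (congrArg IsOpen this).mpr ?_
  exact isOpen_iUnion fun a => hV.preimage (by fun_prop)

/-- Continuity on the projective plane can be checked in homogeneous coordinates. -/
theorem continuousAt_of_coords {Y : Type*} [TopologicalSpace Y] {g : ProjectivePlane → Y}
    {g' : (Fin 3 → ℝ) → Y} {v : Fin 3 → ℝ} (hv : v ≠ 0) (h' : ContinuousAt g' v)
    (h : ∀ᶠ w in 𝓝 v, ∀ hw : w ≠ 0, g (mk w hw) = g' w) : ContinuousAt g (mk v hv) := by
  refine (isOpenQuotientMap_mk.continuousAt_comp_iff (x := ⟨v, hv⟩)).1 ?_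
  have h1 : ContinuousAt (fun w : {v : Fin 3 → ℝ // v ≠ 0} => g' w.1) ⟨v, hv⟩ :=
    h'.comp continuous_subtype_val.continuousAt
  refine h1.congr ?_
  filter_upwards [continuous_subtype_val.continuousAt.eventually h] with w hw
  exact (hw w.2).symm

instance : CompactSpace ProjectivePlane := by
  have h1 : IsCompact (Metric.sphere (0 : Fin 3 → ℝ) 1) := isCompact_sphere _ _
  have h2 : Continuous (fun v : Metric.sphere (0 : Fin 3 → ℝ) 1 =>
      mk v.1 (ne_zero_of_mem_unit_sphere v)) :=
    isOpenQuotientMap_mk.continuous.comp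
      (continuous_subtype_val.subtype_mk fun v => ne_zero_of_mem_unit_sphere v)
  have : CompactSpace (Metric.sphere (0 : Fin 3 → ℝ) 1) := isCompact_iff_compactSpace.1 h1
  refine ⟨?_⟩
  have h3 := isCompact_range h2
  convert h3
  refine (eq_univ_of_forall fun p => ?_).symm
  have hn : ‖coords p‖ ≠ 0 := norm_ne_zero_iff.2 (coords_ne_zero p)
  refine ⟨⟨‖coords p‖⁻¹ • coords p, by simp [norm_smul, hn]⟩, ?_⟩
  conv_rhs => rw [← mk_coords p]
  exact (mk_eq_mk_iff.2 ⟨_, inv_ne_zero hn, rfl⟩).symm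

theorem discA_eq (z : ℂ) (h) : discA z = mk ![z.re, z.im, 2] h := rfl

theorem discB_eq (z : ℂ) (h) : discB z = mk ![2, z.re, z.im] h := rfl

theorem vec3_ne_zero_of_two {a b c : ℝ} (h : c ≠ 0) : ![a, b, c] ≠ 0 := fun h0 =>
  h (by simpa using congrFun h0 2)

theorem vec3_ne_zero_of_zero {a b c : ℝ} (h : a ≠ 0) : ![a, b, c] ≠ 0 := fun h0 =>
  h (by simpa using congrFun h0 0)

/-- The quadratic form that is negative on the open disc `A` and vanishes on its boundary. -/
def formA (v : Fin 3 → ℝ) : ℝ := 4 * (v 0 ^ 2 + v 1 ^ 2) - v 2 ^ 2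

/-- The quadratic form that is negative on the open disc `B` and vanishes on its boundary. -/
def formB (v : Fin 3 → ℝ) : ℝ := 4 * (v 1 ^ 2 + v 2 ^ 2) - v 0 ^ 2

/-- The affine chart `discA`, and the meaning of the sign of `formA` in it. -/
theorem exists_discA_eq {v : Fin 3 → ℝ} (hv : v ≠ 0) (h : v 2 ≠ 0) :
    ∃ z : ℂ, mk v hv = discA z ∧ ‖z‖ ^ 2 = 1 + formA v / v 2 ^ 2 := by
  refine ⟨⟨2 * v 0 / v 2, 2 * v 1 / v 2⟩, ?_, ?_⟩
  · rw [discA_eq _ (vec3_ne_zero_of_two two_ne_zero), mk_eq_mk_iff]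
    refine ⟨2 / v 2, by positivity, ?_⟩
    ext i; fin_cases i <;> simp <;> field_simp
  · rw [← Complex.normSq_eq_norm_sq, Complex.normSq_mk, formA]
    field_simp; ring

/-- The affine chart `discB`, and the meaning of the sign of `formB` in it. -/
theorem exists_discB_eq {v : Fin 3 → ℝ} (hv : v ≠ 0) (h : v 0 ≠ 0) :
    ∃ z : ℂ, mk v hv = discB z ∧ ‖z‖ ^ 2 = 1 + formB v / v 0 ^ 2 := by
  refine ⟨⟨2 * v 1 / v 0, 2 * v 2 / v 0⟩, ?_, ?_⟩
  · rw [discB_eq _ (vec3_ne_zero_of_zero two_ne_zero), mk_eq_mk_iff]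
    refine ⟨2 / v 0, by positivity, ?_⟩
    ext i; fin_cases i <;> simp <;> field_simp
  · rw [← Complex.normSq_eq_norm_sq, Complex.normSq_mk, formB]
    field_simp; ring

theorem formA_smul (a : ℝ) (v : Fin 3 → ℝ) : formA (a • v) = a ^ 2 * formA v := by
  simp [formA]; ring

theorem formB_smul (a : ℝ) (v : Fin 3 → ℝ) : formB (a • v) = a ^ 2 * formB v := by
  simp [formB]; ring

theorem formA_discA (z : ℂ) : formA ![z.re, z.im, 2] = 4 * (‖z‖ ^ 2 - 1) := by
  rw [← Complex.normSq_eq_norm_sq, Complex.normSq_apply]; simp [formA]; ring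

theorem formB_discB (z : ℂ) : formB ![2, z.re, z.im] = 4 * (‖z‖ ^ 2 - 1) := by
  rw [← Complex.normSq_eq_norm_sq, Complex.normSq_apply]; simp [formB]; ring

theorem formA_last_ne_zero {v : Fin 3 → ℝ} (hv : v ≠ 0) (h : formA v ≤ 0) : v 2 ≠ 0 := by
  intro h2
  apply hv
  simp only [formA, h2] at h
  have h0 : v 0 = 0 := by nlinarith [sq_nonneg (v 0), sq_nonneg (v 1)]
  have h1 : v 1 = 0 := by nlinarith [sq_nonneg (v 0), sq_nonneg (v 1)]
  ext i; fin_cases i <;> simp [h0, h1, h2]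

theorem formB_first_ne_zero {v : Fin 3 → ℝ} (hv : v ≠ 0) (h : formB v ≤ 0) : v 0 ≠ 0 := by
  intro h2
  apply hv
  simp only [formB, h2] at h
  have h0 : v 1 = 0 := by nlinarith [sq_nonneg (v 2), sq_nonneg (v 1)]
  have h1 : v 2 = 0 := by nlinarith [sq_nonneg (v 2), sq_nonneg (v 1)]
  ext i; fin_cases i <;> simp [h0, h1, h2]

theorem mk_mem_discA_ball {v : Fin 3 → ℝ} (hv : v ≠ 0) :
    mk v hv ∈ discA '' Metric.ball 0 1 ↔ formA v < 0 := by
  constructor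
  · rintro ⟨z, hz, h⟩
    rw [discA_eq _ (vec3_ne_zero_of_two two_ne_zero)] at h
    obtain ⟨a, ha, rfl⟩ := mk_eq_mk_iff.1 h
    rw [formA_smul, formA_discA]
    have : ‖z‖ < 1 := by simpa using hz
    have : ‖z‖ ^ 2 < 1 := by nlinarith [norm_nonneg z]
    have : 0 < a ^ 2 := by positivity
    nlinarith
  · intro h
    have h2 := formA_last_ne_zero hv h.le
    obtain ⟨z, hz, hn⟩ := exists_discA_eq hv h2
    refine ⟨z, ?_, hz.symm⟩
    have : formA v / v 2 ^ 2 < 0 := div_neg_of_neg_of_pos h (by positivity)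
    have : ‖z‖ < 1 := by nlinarith [norm_nonneg z]
    simpa using this

theorem mk_mem_discB_ball {v : Fin 3 → ℝ} (hv : v ≠ 0) :
    mk v hv ∈ discB '' Metric.ball 0 1 ↔ formB v < 0 := by
  constructor
  · rintro ⟨z, hz, h⟩
    rw [discB_eq _ (vec3_ne_zero_of_zero two_ne_zero)] at h
    obtain ⟨a, ha, rfl⟩ := mk_eq_mk_iff.1 h
    rw [formB_smul, formB_discB]
    have : ‖z‖ < 1 := by simpa using hz
    have : ‖z‖ ^ 2 < 1 := by nlinarith [norm_nonneg z]
    have : 0 < a ^ 2 := by positivity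
    nlinarith
  · intro h
    have h2 := formB_first_ne_zero hv h.le
    obtain ⟨z, hz, hn⟩ := exists_discB_eq hv h2
    refine ⟨z, ?_, hz.symm⟩
    have : formB v / v 0 ^ 2 < 0 := div_neg_of_neg_of_pos h (by positivity)
    have : ‖z‖ < 1 := by nlinarith [norm_nonneg z]
    simpa using this

theorem exists_discA_sphere {v : Fin 3 → ℝ} (hv : v ≠ 0) (h : formA v = 0) :
    ∃ z : ℂ, ‖z‖ = 1 ∧ mk v hv = discA z := by
  obtain ⟨z, hz, hn⟩ := exists_discA_eq hv (formA_last_ne_zero hv h.le)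
  refine ⟨z, ?_, hz⟩
  rw [h] at hn
  have : ‖z‖ ^ 2 = 1 ^ 2 := by rw [hn]; simp
  exact (sq_eq_sq₀ (norm_nonneg z) zero_le_one).1 this

theorem exists_discB_sphere {v : Fin 3 → ℝ} (hv : v ≠ 0) (h : formB v = 0) :
    ∃ z : ℂ, ‖z‖ = 1 ∧ mk v hv = discB z := by
  obtain ⟨z, hz, hn⟩ := exists_discB_eq hv (formB_first_ne_zero hv h.le)
  refine ⟨z, ?_, hz⟩
  rw [h] at hn
  have : ‖z‖ ^ 2 = 1 ^ 2 := by rw [hn]; simp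
  exact (sq_eq_sq₀ (norm_nonneg z) zero_le_one).1 this

theorem isOpen_of_coords {s : Set ProjectivePlane} {q : (Fin 3 → ℝ) → ℝ} (hq : Continuous q)
    (h : ∀ v hv, mk v hv ∈ s ↔ q v < 0) : IsOpen s := by
  rw [← isOpenQuotientMap_mk.isQuotientMap.isOpen_preimage]
  have : (fun v : {v : Fin 3 → ℝ // v ≠ 0} => mk v.1 v.2) ⁻¹' s = {v | q v.1 < 0} := by
    ext v; exact h v.1 v.2
  rw [this]
  exact isOpen_lt (by fun_prop) continuous_const

theorem isOpen_discA_ball : IsOpen (discA '' Metric.ball 0 1) :=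
  isOpen_of_coords (q := formA) (by unfold formA; fun_prop) fun _ hv => mk_mem_discA_ball hv

theorem isOpen_discB_ball : IsOpen (discB '' Metric.ball 0 1) :=
  isOpen_of_coords (q := formB) (by unfold formB; fun_prop) fun _ hv => mk_mem_discB_ball hv

end ProjectivePlane

instance (h : ℕ) : CompactSpace (PuncturedProjectivePlanes h) := by
  refine isCompact_iff_compactSpace.1 (IsClosed.isCompact ?_)
  have h1 := (ProjectivePlane.isOpen_discA_ball.preimage
    (continuous_snd (X := Fin h) (Y := ProjectivePlane))).isClosed_compl
  have h2 := (ProjectivePlane.isOpen_discB_ball.preimage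
    (continuous_snd (X := Fin h) (Y := ProjectivePlane))).isClosed_compl
  have hd : ∀ s : Set (Fin h), IsClosed (Prod.fst ⁻¹' s : Set (Fin h × ProjectivePlane)) :=
    fun s => (isClosed_discrete s).preimage continuous_fst
  have := ((hd {i | ¬ 0 < (i : ℕ)}).union h1).inter ((hd {i | ¬ (i : ℕ) + 1 < h}).union h2)
  refine (congrArg IsClosed (Set.ext fun p => ?_)).mp this
  exact and_congr imp_iff_not_or.symm imp_iff_not_or.symm

instance (h : ℕ) : CompactSpace (NonorientableSurface h) :=
  inferInstanceAs (CompactSpace (Quot _))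

/-! ### The circle of directions -/

/-- The line `ℝ v` as a point of `ℝP¹ = S¹`, where a line is recorded by the square of its unit
vectors. The value at `0` is not used. -/
noncomputable def lineDir (v : ℂ) : Circle :=
  if h : v = 0 then 1 else Circle.ofConjDivSelf (conj v) (by simpa using h)

theorem coe_lineDir {v : ℂ} (h : v ≠ 0) : (lineDir v : ℂ) = v / conj v := by
  simp [lineDir, h, Circle.ofConjDivSelf]

/-- The vector `v` lies in the line with direction `t`. -/
def OnLine (t : Circle) (v : ℂ) : Prop := v = t * conj v

theorem onLine_lineDir (v : ℂ) : OnLine (lineDir v) v := by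
  by_cases h : v = 0
  · simp [OnLine, h]
  · have : conj v ≠ 0 := by simpa using h
    rw [OnLine, coe_lineDir h]; field_simp

theorem OnLine.eq_lineDir {t : Circle} {v : ℂ} (h : OnLine t v) (hv : v ≠ 0) : t = lineDir v := by
  have : conj v ≠ 0 := by simpa using hv
  apply Circle.ext
  rw [coe_lineDir hv, eq_div_iff this]; exact h.symm

theorem OnLine.real_smul {t : Circle} {v : ℂ} (h : OnLine t v) (a : ℝ) : OnLine t (a * v) := by
  unfold OnLine at *
  rw [map_mul, Complex.conj_ofReal]
  linear_combination (a : ℂ) * h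

theorem onLine_lineDir_iff {v w : ℂ} (hv : v ≠ 0) :
    OnLine (lineDir v) w ↔ v.re * w.im = v.im * w.re := by
  have : conj v ≠ 0 := by simpa using hv
  rw [OnLine, coe_lineDir hv, div_mul_eq_mul_div, eq_div_iff this, Complex.ext_iff]
  simp only [Complex.mul_re, Complex.mul_im, Complex.conj_re, Complex.conj_im]
  constructor
  · rintro ⟨-, h⟩; linarith
  · intro h; constructor <;> linarith

theorem lineDir_real_mul {a : ℝ} (ha : a ≠ 0) (v : ℂ) : lineDir (a * v) = lineDir v := by
  by_cases h : v = 0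
  · simp [h]
  · exact (((onLine_lineDir v).real_smul a).eq_lineDir (by simp [ha, h])).symm

theorem exists_real_mul_of_onLine {t : Circle} {v w : ℂ} (hv : OnLine t v) (hw : OnLine t w)
    (h : v ≠ 0) : ∃ a : ℝ, w = a * v := by
  rw [hv.eq_lineDir h, onLine_lineDir_iff h] at hw
  have hn : Complex.normSq v ≠ 0 := by simpa using h
  refine ⟨(v.re * w.re + v.im * w.im) / Complex.normSq v, ?_⟩
  rw [Complex.normSq_apply] at hn ⊢
  apply Complex.ext
  · rw [Complex.re_ofReal_mul, div_mul_eq_mul_div, eq_div_iff hn]; linear_combination (-v.im) * hw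
  · rw [Complex.im_ofReal_mul, div_mul_eq_mul_div, eq_div_iff hn]; linear_combination (v.re) * hw

theorem lineDir_eq_iff {v w : ℂ} (hv : v ≠ 0) (hw : w ≠ 0) :
    lineDir v = lineDir w ↔ v.re * w.im = v.im * w.re := by
  rw [← onLine_lineDir_iff hv]
  exact ⟨fun h => h ▸ onLine_lineDir w, fun h => h.eq_lineDir hw⟩

theorem exists_lineDir_eq (t : Circle) : ∃ v : ℂ, v ≠ 0 ∧ lineDir v = t := by
  by_cases h : (t : ℂ) = -1
  · refine ⟨Complex.I, Complex.I_ne_zero, (OnLine.eq_lineDir ?_ Complex.I_ne_zero).symm⟩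
    simp [OnLine, h]
  · have h0 : (1 : ℂ) + t ≠ 0 := fun h' => h (by linear_combination h')
    refine ⟨1 + t, h0, (OnLine.eq_lineDir ?_ h0).symm⟩
    have := Circle.coe_inv_eq_conj t
    rw [OnLine, map_add, map_one, ← this, Circle.coe_inv]
    have := t.coe_ne_zero
    field_simp; ring

theorem continuousAt_lineDir {v : ℂ} (h : v ≠ 0) : ContinuousAt lineDir v := by
  have hc : IsEmbedding (fun t : Circle => (t : ℂ)) := IsEmbedding.subtypeVal
  rw [hc.continuousAt_iff]
  have h1 : ContinuousAt (fun w : ℂ => w / conj w) v :=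
    continuousAt_id.div Complex.continuous_conj.continuousAt (by simpa using h)
  refine h1.congr ?_
  filter_upwards [isOpen_ne.mem_nhds h] with w hw
  exact (coe_lineDir hw).symm

/-! ### The surface in the torus -/

/-- The blown-up points lie on a line; these are their coordinates on it, the orbit of `0` under
the affine contraction `a ↦ 10 / 21 - 4 / 21 * a`. -/
noncomputable def blowPt (n : ℕ) : ℝ := 2 / 5 * (1 - (-4 / 21) ^ n)

theorem blowPt_injective : Function.Injective blowPt := by
  intro m n h
  have h1 : ((-4 / 21 : ℝ)) ^ m = (-4 / 21) ^ n := by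
    unfold blowPt at h; linarith
  have h2 : ((4 / 21 : ℝ)) ^ m = (4 / 21) ^ n := by
    have := congrArg abs h1
    rw [abs_pow, abs_pow] at this
    norm_num [abs_of_pos] at this ⊢
    exact this
  exact pow_right_injective₀ (by norm_num) (by norm_num) h2

/-- The product of the linear forms on `ℝ² = ℂ` that cut out the directions of the points
with indices in `I`. -/
noncomputable def rForm (I : Finset ℕ) (S : ℂ) : ℝ := ∏ i ∈ I, (2 * S.im - blowPt i * S.re)

/-- A positive form on `ℝ²` whose degree is one less than that of `rForm I`, for `I` of odd
cardinality. -/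
noncomputable def qForm (I : Finset ℕ) (S : ℂ) : ℝ := Complex.normSq S ^ ((I.card - 1) / 2)

/-- At the point `[z₀ S : z₁]` of the projective plane, the pair of forms whose ratio is the
circle-valued coordinate that resolves the points with indices in `I`. -/
noncomputable def blowVec (I : Finset ℕ) (S : ℂ) (z₀ z₁ : ℝ) : ℂ := ⟨z₁ * qForm I S, z₀ * rForm I S⟩

theorem rForm_smul (I : Finset ℕ) (a : ℝ) (S : ℂ) : rForm I (a * S) = a ^ I.card * rForm I S := by
  unfold rForm
  rw [← Finset.prod_const, ← Finset.prod_mul_distrib]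
  refine Finset.prod_congr rfl fun i _ => ?_
  rw [Complex.re_ofReal_mul, Complex.im_ofReal_mul]; ring

/-- The degree of `qForm I` is `I.card - 1` only if this number is even. Hence both components of
`blowVec I` have the same degree, as they must for their ratio to be a function on the plane. -/
theorem qForm_smul {I : Finset ℕ} (hI : Odd I.card) (a : ℝ) (S : ℂ) :
    a * qForm I (a * S) = a ^ I.card * qForm I S := by
  obtain ⟨k, hk⟩ := hI
  have : (I.card - 1) / 2 = k := by omega
  unfold qForm
  rw [this, hk, map_mul, Complex.normSq_ofReal, mul_pow, ← sq, ← pow_mul]; ring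

theorem qForm_pos (I : Finset ℕ) {S : ℂ} (hS : S ≠ 0) : 0 < qForm I S :=
  pow_pos (Complex.normSq_pos.2 hS) _

theorem blowVec_smul {I : Finset ℕ} (hI : Odd I.card) (a : ℝ) (S : ℂ) (z₀ z₁ : ℝ) :
    blowVec I (a * S) z₀ (a * z₁) = (a ^ I.card : ℝ) * blowVec I S z₀ z₁ := by
  unfold blowVec
  apply Complex.ext
  · rw [Complex.re_ofReal_mul]
    simp only
    linear_combination z₁ * qForm_smul hI a S
  · rw [Complex.im_ofReal_mul]
    simp only
    rw [rForm_smul]; ring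

theorem blowVec_mul (I : Finset ℕ) (a : ℝ) (S : ℂ) (z₀ z₁ : ℝ) :
    blowVec I S (a * z₀) (a * z₁) = a * blowVec I S z₀ z₁ := by
  apply Complex.ext
  · rw [Complex.re_ofReal_mul]; simp only [blowVec]; ring
  · rw [Complex.im_ofReal_mul]; simp only [blowVec]; ring

theorem exists_factor_eq_zero {I : Finset ℕ} {S : ℂ} (h : rForm I S = 0) :
    ∃ i ∈ I, 2 * S.im = blowPt i * S.re := by
  obtain ⟨i, hi, h0⟩ := Finset.prod_eq_zero_iff.1 h
  exact ⟨i, hi, by linarith⟩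

/-- The blown-up points are in the affine plane `S.re ≠ 0`. -/
theorem re_ne_zero_of_factor {i : ℕ} {S : ℂ} (hS : S ≠ 0) (h : 2 * S.im = blowPt i * S.re) :
    S.re ≠ 0 := by
  intro h0
  rw [h0] at h
  exact hS (Complex.ext h0 (by simpa using h))

/-- The directions of distinct blown-up points are distinct. -/
theorem factor_unique {i j : ℕ} {S : ℂ} (hS : S ≠ 0) (hi : 2 * S.im = blowPt i * S.re)
    (hj : 2 * S.im = blowPt j * S.re) : i = j :=
  blowPt_injective (mul_right_cancel₀ (re_ne_zero_of_factor hS hi) (hi.symm.trans hj))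

theorem not_both_rForm_eq_zero {I J : Finset ℕ} (hIJ : Disjoint I J) {S : ℂ} (hS : S ≠ 0)
    (hI : rForm I S = 0) (hJ : rForm J S = 0) : False := by
  obtain ⟨i, hi, h1⟩ := exists_factor_eq_zero hI
  obtain ⟨j, hj, h2⟩ := exists_factor_eq_zero hJ
  exact Finset.disjoint_left.1 hIJ hi (factor_unique hS h1 h2 ▸ hj)

/-- The point `x` of the torus lies over the point `[z₀ S : z₁]` of the projective plane blown up
at `[0 : 0 : 1]`, at the direction of `S` in case `z₀ = 0`. -/
structure LiesOver (I J : Finset ℕ) (x : ThreeTorus) (S : ℂ) (z₀ z₁ : ℝ) : Prop where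
  ne : S ≠ 0
  ne' : z₀ ≠ 0 ∨ z₁ ≠ 0
  dir : OnLine x.1 S
  dirI : OnLine x.2.1 (blowVec I S z₀ z₁)
  dirJ : OnLine x.2.2 (blowVec J S z₀ z₁)

/-- The blow-up of the projective plane at `[0 : 0 : 1]` and at the points with indices in `I` and
`J`, as a subset of the torus. -/
def blowSurface (I J : Finset ℕ) : Set ThreeTorus := {x | ∃ S z₀ z₁, LiesOver I J x S z₀ z₁}

theorem LiesOver.rescale {I J : Finset ℕ} (hI : Odd I.card) (hJ : Odd J.card) {x : ThreeTorus}
    {S : ℂ} {z₀ z₁ : ℝ} (h : LiesOver I J x S z₀ z₁) {a : ℝ} (ha : a ≠ 0) :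
    LiesOver I J x (a * S) z₀ (a * z₁) where
  ne := by simpa [ha] using h.ne
  ne' := h.ne'.imp id fun h => mul_ne_zero ha h
  dir := h.dir.real_smul a
  dirI := by rw [blowVec_smul hI]; exact h.dirI.real_smul _
  dirJ := by rw [blowVec_smul hJ]; exact h.dirJ.real_smul _

/-- A point of the surface lies over a single point of the blown-up projective plane. -/
theorem LiesOver.unique {I J : Finset ℕ} (hIJ : Disjoint I J) (hI : Odd I.card) (hJ : Odd J.card)
    {x : ThreeTorus} {S S' : ℂ} {z₀ z₁ z₀' z₁' : ℝ} (h : LiesOver I J x S z₀ z₁)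
    (h' : LiesOver I J x S' z₀' z₁') :
    ∃ a b : ℝ, a ≠ 0 ∧ b ≠ 0 ∧ S' = a * S ∧ z₀' = b * z₀ ∧ z₁' = b * a * z₁ := by
  obtain ⟨a, ha⟩ := exists_real_mul_of_onLine h.dir h'.dir h.ne
  have ha0 : a ≠ 0 := by rintro rfl; exact h'.ne (by simpa using ha)
  have h1 := h.rescale hI hJ ha0
  rw [← ha] at h1
  set S₁ := S'
  obtain ⟨T, hT, hT'⟩ := exists_lineDir_eq x.2.1
  obtain ⟨M, hM, hM'⟩ := exists_lineDir_eq x.2.2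
  have e1 := h1.dirI
  have e2 := h1.dirJ
  have e3 := h'.dirI
  have e4 := h'.dirJ
  rw [← hT', onLine_lineDir_iff hT] at e1 e3
  rw [← hM', onLine_lineDir_iff hM] at e2 e4
  simp only [blowVec] at e1 e2 e3 e4
  have hq := qForm_pos I h'.ne
  have hq' := qForm_pos J h'.ne
  -- two independent solutions of the linear conditions would make both of them trivial
  have hdet : z₀ * z₁' = z₀' * (a * z₁) := by
    by_contra hne
    have hne' := sub_ne_zero.2 hne
    have f1 : T.im * qForm I S₁ = 0 := by
      have : (z₀ * z₁' - z₀' * (a * z₁)) * (T.im * qForm I S₁) = 0 := by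
        linear_combination z₀' * e1 - z₀ * e3
      exact (mul_eq_zero.1 this).resolve_left hne'
    have f2 : T.re * rForm I S₁ = 0 := by
      have : (z₀ * z₁' - z₀' * (a * z₁)) * (T.re * rForm I S₁) = 0 := by
        linear_combination z₁' * e1 - (a * z₁) * e3
      exact (mul_eq_zero.1 this).resolve_left hne'
    have f3 : M.im * qForm J S₁ = 0 := by
      have : (z₀ * z₁' - z₀' * (a * z₁)) * (M.im * qForm J S₁) = 0 := by
        linear_combination z₀' * e2 - z₀ * e4
      exact (mul_eq_zero.1 this).resolve_left hne'
    have f4 : M.re * rForm J S₁ = 0 := by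
      have : (z₀ * z₁' - z₀' * (a * z₁)) * (M.re * rForm J S₁) = 0 := by
        linear_combination z₁' * e2 - (a * z₁) * e4
      exact (mul_eq_zero.1 this).resolve_left hne'
    have g1 : T.im = 0 := (mul_eq_zero.1 f1).resolve_right hq.ne'
    have g2 : M.im = 0 := (mul_eq_zero.1 f3).resolve_right hq'.ne'
    have g3 : T.re ≠ 0 := fun h => hT (Complex.ext h g1)
    have g4 : M.re ≠ 0 := fun h => hM (Complex.ext h g2)
    exact not_both_rForm_eq_zero hIJ h'.ne ((mul_eq_zero.1 f2).resolve_left g3)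
      ((mul_eq_zero.1 f4).resolve_left g4)
  by_cases hz : z₀ = 0
  · have hz1 : z₁ ≠ 0 := h.ne'.resolve_left (not_not.2 hz)
    have hz0 : z₀' = 0 := by
      rw [hz, zero_mul] at hdet
      exact (mul_eq_zero.1 hdet.symm).resolve_right (mul_ne_zero ha0 hz1)
    have hz1' : z₁' ≠ 0 := h'.ne'.resolve_left (not_not.2 hz0)
    refine ⟨a, z₁' / (a * z₁), ha0, by positivity, ha, by simp [hz, hz0], by field_simp⟩
  · have hz0 : z₀' ≠ 0 := by
      intro h0
      rw [h0, zero_mul] at hdet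
      exact (h'.ne'.resolve_left (not_not.2 h0)) ((mul_eq_zero.1 hdet).resolve_left hz)
    refine ⟨a, z₀' / z₀, ha0, by positivity, ha, by field_simp, ?_⟩
    field_simp
    linear_combination hdet

/-- The equation of the surface in terms of vectors spanning the three lines. -/
noncomputable def surfaceEq (I J : Finset ℕ) (S T M : ℂ) : ℝ :=
  T.re * rForm I S * (M.im * qForm J S) - M.re * rForm J S * (T.im * qForm I S)

/-- The point `[z₀ : z₁]` in `LiesOver` solves two homogeneous linear equations, and the determinant
of these is `surfaceEq`. -/
theorem mem_blowSurface_iff {I J : Finset ℕ} (hIJ : Disjoint I J) (hI : Odd I.card)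
    (hJ : Odd J.card) {S T M : ℂ} (hS : S ≠ 0) (hT : T ≠ 0) (hM : M ≠ 0) :
    (lineDir S, lineDir T, lineDir M) ∈ blowSurface I J ↔ surfaceEq I J S T M = 0 := by
  have hq := qForm_pos I hS
  have hq' := qForm_pos J hS
  constructor
  · rintro ⟨S', z₀, z₁, h⟩
    obtain ⟨a, ha⟩ := exists_real_mul_of_onLine h.dir (onLine_lineDir S) h.ne
    have ha0 : a ≠ 0 := by rintro rfl; exact hS (by simpa using ha)
    have h1 := h.rescale hI hJ ha0
    rw [← ha] at h1
    have e1 := (onLine_lineDir_iff hT).1 h1.dirI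
    have e2 := (onLine_lineDir_iff hM).1 h1.dirJ
    simp only [blowVec] at e1 e2
    unfold surfaceEq
    rcases h1.ne' with hz | hz
    · refine (mul_eq_zero.1 (?_ : z₀ * _ = 0)).resolve_left hz
      linear_combination (M.im * qForm J S) * e1 - (T.im * qForm I S) * e2
    · refine (mul_eq_zero.1 (?_ : (a * z₁) * _ = 0)).resolve_left hz
      linear_combination (M.re * rForm J S) * e1 - (T.re * rForm I S) * e2
  · intro h
    unfold surfaceEq at h
    -- a nonzero solution of the first linear equation, or of the second one if the first is trivial
    by_cases h0 : T.im * qForm I S = 0 ∧ T.re * rForm I S = 0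
    · have g1 : T.im = 0 := (mul_eq_zero.1 h0.1).resolve_right hq.ne'
      have g3 : T.re ≠ 0 := fun h => hT (Complex.ext h g1)
      have g2 : rForm J S ≠ 0 := fun h =>
        not_both_rForm_eq_zero hIJ hS ((mul_eq_zero.1 h0.2).resolve_left g3) h
      refine ⟨S, M.im * qForm J S, M.re * rForm J S, hS, ?_, onLine_lineDir S,
        (onLine_lineDir_iff hT).2 ?_, (onLine_lineDir_iff hM).2 ?_⟩
      · by_contra! hc
        exact hM (Complex.ext ((mul_eq_zero.1 hc.2).resolve_right g2)
          ((mul_eq_zero.1 hc.1).resolve_right hq'.ne'))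
      · simp only [blowVec]; linear_combination h
      · simp only [blowVec]; ring
    · refine ⟨S, T.im * qForm I S, T.re * rForm I S, hS, ?_, onLine_lineDir S,
        (onLine_lineDir_iff hT).2 ?_, (onLine_lineDir_iff hM).2 ?_⟩
      · by_contra! hc
        exact h0 hc
      · simp only [blowVec]; ring
      · simp only [blowVec]; linear_combination -h

/-! ### Smoothness of the surface -/

/-- A vector spanning the line `t`, depending smoothly on `t` and equal to `v` at the line of `v`;
it vanishes only at the line orthogonal to `v`. -/
noncomputable def spanning (v : ℂ) (t : Circle) : ℂ := v * (1 + t * (lineDir v : ℂ)⁻¹) / 2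

theorem onLine_spanning {v : ℂ} (hv : v ≠ 0) (t : Circle) : OnLine t (spanning v t) := by
  have h1 := Circle.coe_inv_eq_conj t
  have hv' : conj v ≠ 0 := by simpa using hv
  have ht := t.coe_ne_zero
  rw [Circle.coe_inv] at h1
  unfold OnLine spanning
  rw [coe_lineDir hv]
  simp only [map_div₀, map_mul, map_add, map_one, map_inv₀, ← h1, Complex.conj_conj]
  rw [show conj (2 : ℂ) = 2 from Complex.conj_ofReal 2]
  field_simp
  ring

theorem spanning_ne_zero {v : ℂ} (hv : v ≠ 0) {t : Circle} (ht : t ≠ -lineDir v) :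
    spanning v t ≠ 0 := by
  have h0 := (lineDir v).coe_ne_zero
  refine div_ne_zero (mul_ne_zero hv fun h => ht ?_) two_ne_zero
  apply Circle.ext
  rw [Circle.coe_neg]
  field_simp at h
  linear_combination h

theorem spanning_self {v : ℂ} : spanning v (lineDir v) = v := by
  have h0 := (lineDir v).coe_ne_zero
  unfold spanning
  field_simp; norm_num

theorem contMDiff_coe_circle : ContMDiff (𝓡 1) 𝓘(ℝ, ℂ) ∞ (fun t : Circle => (t : ℂ)) :=
  have : Fact (Module.finrank ℝ ℂ = 1 + 1) := finrank_real_complex_fact'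
  contMDiff_coe_sphere (E := ℂ) (n := 1)

theorem contMDiff_spanning (v : ℂ) : ContMDiff (𝓡 1) 𝓘(ℝ, ℂ) ∞ (spanning v) := by
  have h : ContDiff ℝ ∞ (fun t : ℂ => v * (1 + t * (lineDir v : ℂ)⁻¹) / 2) := by fun_prop
  exact h.contMDiff.comp contMDiff_coe_circle

theorem hasDerivAt_spanning (v : ℂ) :
    HasDerivAt (fun s : ℝ => spanning v (lineDir v * Circle.exp s)) (v * Complex.I / 2) 0 := by
  have h0 := (lineDir v).coe_ne_zero
  have h1 : HasDerivAt (fun s : ℝ => Complex.exp (s * Complex.I)) (Complex.I) 0 := by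
    have := ((Complex.ofRealCLM.hasDerivAt (x := 0)).mul_const Complex.I).cexp
    simpa using this
  have h2 := (((h1.const_add 1).const_mul v).div_const 2)
  refine h2.congr_of_eventuallyEq (.of_forall fun s => ?_)
  simp only [spanning, Circle.coe_mul, Circle.coe_exp]
  field_simp

theorem contDiff_rForm (I : Finset ℕ) : ContDiff ℝ ∞ (rForm I) := by
  unfold rForm
  refine contDiff_prod fun i _ => ?_
  exact (contDiff_const.mul Complex.imCLM.contDiff).sub
    (contDiff_const.mul Complex.reCLM.contDiff)

theorem contDiff_qForm (I : Finset ℕ) : ContDiff ℝ ∞ (qForm I) := by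
  have h : ContDiff ℝ ∞ (fun S : ℂ => Complex.normSq S) := by
    simp only [Complex.normSq_apply]
    exact (Complex.reCLM.contDiff.mul Complex.reCLM.contDiff).add
      (Complex.imCLM.contDiff.mul Complex.imCLM.contDiff)
  exact h.pow _

theorem contDiff_surfaceEq (I J : Finset ℕ) :
    ContDiff ℝ ∞ (fun x : ℂ × ℂ × ℂ => surfaceEq I J x.1 x.2.1 x.2.2) := by
  have hr : ∀ K, ContDiff ℝ ∞ (fun x : ℂ × ℂ × ℂ => rForm K x.1) := fun K =>
    (contDiff_rForm K).comp contDiff_fst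
  have hq : ∀ K, ContDiff ℝ ∞ (fun x : ℂ × ℂ × ℂ => qForm K x.1) := fun K =>
    (contDiff_qForm K).comp contDiff_fst
  have hT : ContDiff ℝ ∞ (fun x : ℂ × ℂ × ℂ => x.2.1) := by fun_prop
  have hM : ContDiff ℝ ∞ (fun x : ℂ × ℂ × ℂ => x.2.2) := by fun_prop
  have re := fun {g : ℂ × ℂ × ℂ → ℂ} (h : ContDiff ℝ ∞ g) => Complex.reCLM.contDiff.comp h
  have im := fun {g : ℂ × ℂ × ℂ → ℂ} (h : ContDiff ℝ ∞ g) => Complex.imCLM.contDiff.comp h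
  exact (((re hT).mul (hr I)).mul ((im hM).mul (hq J))).sub
    (((re hM).mul (hr J)).mul ((im hT).mul (hq I)))

/-- The form `rForm I` has simple zeros: rotating `S` makes it vary to first order. -/
theorem hasDerivAt_rForm_spanning {I : Finset ℕ} {S : ℂ} (hS : S ≠ 0) (h : rForm I S = 0) :
    ∃ d : ℝ, d ≠ 0 ∧
      HasDerivAt (fun s : ℝ => rForm I (spanning S (lineDir S * Circle.exp s))) d 0 := by
  obtain ⟨i, hi, h0⟩ := exists_factor_eq_zero h
  set σ : ℝ → ℂ := fun s => spanning S (lineDir S * Circle.exp s) with hσ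
  have hσ0 : σ 0 = S := by simp [hσ, spanning_self]
  have hσd : HasDerivAt σ (S * Complex.I / 2) 0 := hasDerivAt_spanning S
  have hre : HasDerivAt (fun s => (σ s).re) (-S.im / 2) 0 := by
    have := Complex.reCLM.hasFDerivAt.comp_hasDerivAt (0 : ℝ) hσd
    convert! this using 1
    simp [Complex.div_ofNat_re]
  have him : HasDerivAt (fun s => (σ s).im) (S.re / 2) 0 := by
    have := Complex.imCLM.hasFDerivAt.comp_hasDerivAt (0 : ℝ) hσd
    convert! this using 1
    simp [Complex.div_ofNat_im]
  have hl := (him.const_mul 2).sub (hre.const_mul (blowPt i))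
  have hR : DifferentiableAt ℝ (fun s => rForm (I.erase i) (σ s)) 0 :=
    ((contDiff_rForm _).differentiable (by simp) _).comp (0 : ℝ) hσd.differentiableAt
  have hR0 : rForm (I.erase i) S ≠ 0 := by
    intro hz
    obtain ⟨j, hj, h1⟩ := exists_factor_eq_zero hz
    exact Finset.ne_of_mem_erase hj (factor_unique hS h1 h0)
  refine ⟨_, ?_, (hl.mul hR.hasDerivAt).congr_of_eventuallyEq (.of_forall fun s => ?_)⟩
  · have hre0 := re_ne_zero_of_factor hS h0
    simp only [hσ0, Pi.sub_apply]
    rw [h0, sub_self, zero_mul, add_zero]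
    refine mul_ne_zero ?_ hR0
    have : S.im = blowPt i * S.re / 2 := by linarith
    rw [this]
    have h2 : 2 * (S.re / 2) - blowPt i * (-(blowPt i * S.re / 2) / 2) =
        S.re * (1 + blowPt i ^ 2 / 4) := by ring
    rw [h2]
    positivity
  · simp only [rForm, Pi.mul_apply, Pi.sub_apply]
    rw [← Finset.mul_prod_erase I _ hi]

theorem hasDerivAt_re_im_spanning (v : ℂ) (a b : ℝ) :
    HasDerivAt (fun s : ℝ => a * (spanning v (lineDir v * Circle.exp s)).im -
      b * (spanning v (lineDir v * Circle.exp s)).re) ((a * v.re + b * v.im) / 2) 0 := by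
  have hσd := hasDerivAt_spanning v
  have hre := Complex.reCLM.hasFDerivAt.comp_hasDerivAt (0 : ℝ) hσd
  have him := Complex.imCLM.hasFDerivAt.comp_hasDerivAt (0 : ℝ) hσd
  convert! (him.const_mul a).sub (hre.const_mul b) using 1
  simp [Complex.div_ofNat_re, Complex.div_ofNat_im]
  ring

theorem eq_zero_of_rotation {a b : ℝ} {v : ℂ} (hv : v ≠ 0) (h : a * v.im - b * v.re = 0)
    (h' : (a * v.re + b * v.im) / 2 = 0) : a = 0 ∧ b = 0 := by
  have hn := Complex.normSq_pos.2 hv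
  rw [Complex.normSq_apply] at hn
  constructor
  · refine (mul_eq_zero.1 (?_ : a * (v.re * v.re + v.im * v.im) = 0)).resolve_right hn.ne'
    linear_combination v.im * h + 2 * v.re * h'
  · refine (mul_eq_zero.1 (?_ : b * (v.re * v.re + v.im * v.im) = 0)).resolve_right hn.ne'
    linear_combination -v.re * h + 2 * v.im * h'

theorem mdifferentiableAt_rotation (t : Circle) :
    MDifferentiableAt 𝓘(ℝ, ℝ) (𝓡 1) (fun s : ℝ => t * Circle.exp s) 0 := by
  have h : ContMDiff 𝓘(ℝ, ℝ) (𝓡 1) ω (fun s : ℝ => t * Circle.exp s) :=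
    contMDiff_const.mul contMDiff_circleExp
  exact (h 0).mdifferentiableAt (by simp)

/-- The equation of the surface is regular: rotating one of the three lines moves off the
surface to first order. -/
theorem exists_curve_deriv_ne_zero {I J : Finset ℕ} (hIJ : Disjoint I J) {S T M : ℂ} (hS : S ≠ 0)
    (hT : T ≠ 0) (hM : M ≠ 0) (h : surfaceEq I J S T M = 0) :
    ∃ c : ℝ → ThreeTorus, c 0 = (lineDir S, lineDir T, lineDir M) ∧
      MDifferentiableAt 𝓘(ℝ, ℝ) ((𝓡 1).prod ((𝓡 1).prod (𝓡 1))) c 0 ∧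
      deriv (fun s => surfaceEq I J (spanning S (c s).1) (spanning T (c s).2.1)
        (spanning M (c s).2.2)) 0 ≠ 0 := by
  have hq := (qForm_pos I hS).ne'
  have hq' := (qForm_pos J hS).ne'
  have hconst : ∀ t : Circle, MDifferentiableAt 𝓘(ℝ, ℝ) (𝓡 1) (fun _ : ℝ => t) 0 :=
    fun t => mdifferentiableAt_const
  by_contra! hc
  have h1 := hc (fun s => (lineDir S, lineDir T, lineDir M * Circle.exp s)) (by simp)
    ((hconst _).prodMk ((hconst _).prodMk (mdifferentiableAt_rotation _)))
  have h2 := hc (fun s => (lineDir S, lineDir T * Circle.exp s, lineDir M)) (by simp)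
    ((hconst _).prodMk ((mdifferentiableAt_rotation _).prodMk (hconst _)))
  have h3 := hc (fun s => (lineDir S * Circle.exp s, lineDir T, lineDir M)) (by simp)
    ((mdifferentiableAt_rotation _).prodMk ((hconst _).prodMk (hconst _)))
  simp only [spanning_self, surfaceEq] at h1 h2 h3 h
  -- the vanishing of the derivatives in `T` and `M` makes the coefficients of the equation vanish
  have e1 := hasDerivAt_re_im_spanning M (T.re * rForm I S * qForm J S)
    (rForm J S * (T.im * qForm I S))
  have e2 := hasDerivAt_re_im_spanning T (M.re * rForm J S * qForm I S)
    (rForm I S * (M.im * qForm J S))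
  have k1 := eq_zero_of_rotation hM (by linear_combination h)
    (e1.deriv.symm.trans ((congrArg (deriv · 0) (funext fun s => by ring)).trans h1))
  have k2 := eq_zero_of_rotation hT (by linear_combination -h)
    (neg_eq_zero.1 (e2.neg.deriv.symm.trans
      ((congrArg (deriv · 0) (funext fun s => by simp only [Pi.neg_apply]; ring)).trans h2)))
  -- then exactly one of the forms vanishes at `S`, and the derivative in `S` is that of a simple zero
  by_cases hr : rForm I S = 0
  · have hr' : rForm J S ≠ 0 := fun h' => not_both_rForm_eq_zero hIJ hS hr h'
    have hTi : T.im = 0 := by simpa [hr', hq] using k1.2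
    have hMr : M.re = 0 := by simpa [hr', hq] using k2.1
    have hTr : T.re ≠ 0 := fun h => hT (Complex.ext h hTi)
    have hMi : M.im ≠ 0 := fun h => hM (Complex.ext hMr h)
    obtain ⟨d, hd, hd'⟩ := hasDerivAt_rForm_spanning hS hr
    have hQ : DifferentiableAt ℝ (fun s : ℝ => qForm J (spanning S (lineDir S * Circle.exp s))) 0 :=
      ((contDiff_qForm _).differentiable (by simp) _).comp (0 : ℝ)
        (hasDerivAt_spanning S).differentiableAt
    have e3 := (hd'.const_mul T.re).mul (hQ.hasDerivAt.const_mul M.im)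
    have := e3.deriv.symm.trans ((congrArg (deriv · 0) (funext fun s => by simp [hTi, hMr])).trans h3)
    simp [spanning_self, hr, hTr, hMi, hd, hq'] at this
  · have hTr : T.re = 0 := by simpa [hr, hq'] using k1.1
    have hMi : M.im = 0 := by simpa [hr, hq'] using k2.2
    have hTi : T.im ≠ 0 := fun h => hT (Complex.ext hTr h)
    have hMr : M.re ≠ 0 := fun h => hM (Complex.ext h hMi)
    have hr' : rForm J S = 0 := by simpa [hTi, hq] using k1.2
    obtain ⟨d, hd, hd'⟩ := hasDerivAt_rForm_spanning hS hr'
    have hQ : DifferentiableAt ℝ (fun s : ℝ => qForm I (spanning S (lineDir S * Circle.exp s))) 0 :=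
      ((contDiff_qForm _).differentiable (by simp) _).comp (0 : ℝ)
        (hasDerivAt_spanning S).differentiableAt
    have e3 := ((hd'.const_mul M.re).mul (hQ.hasDerivAt.const_mul T.im)).neg
    have := e3.deriv.symm.trans ((congrArg (deriv · 0) (funext fun s => by simp [hTr, hMi])).trans h3)
    simp [spanning_self, hr', hTi, hMr, hd, hq] at this

/-- A space embedded in the torus with image `blowSurface I J` is a smooth submanifold. -/
theorem exists_smooth_structure_of_range_eq {I J : Finset ℕ} (hIJ : Disjoint I J)
    (hI : Odd I.card) (hJ : Odd J.card) {X : Type*} [TopologicalSpace X] {f : X → ThreeTorus}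
    (hf : IsEmbedding f) (hr : range f = blowSurface I J) :
    ∃ (_ : ChartedSpace (EuclideanSpace ℝ (Fin 2)) X) (_ : IsManifold (𝓡 2) ∞ X),
      Manifold.IsSmoothEmbedding (𝓡 2) ((𝓡 1).prod ((𝓡 1).prod (𝓡 1))) ∞ f := by
  have hdim : Module.finrank ℝ (EuclideanSpace ℝ (Fin 1) × EuclideanSpace ℝ (Fin 1) ×
      EuclideanSpace ℝ (Fin 1)) = 3 := by simp
  refine hf.exists_smooth_structure ((𝓡 1).prod ((𝓡 1).prod (𝓡 1)))
    (ContinuousLinearEquiv.ofFinrankEq (by rw [hdim]; simp)) fun x => ?_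
  obtain ⟨S, hS, hS'⟩ := exists_lineDir_eq (f x).1
  obtain ⟨T, hT, hT'⟩ := exists_lineDir_eq (f x).2.1
  obtain ⟨M, hM, hM'⟩ := exists_lineDir_eq (f x).2.2
  have hx : f x = (lineDir S, lineDir T, lineDir M) := by rw [hS', hT', hM']
  have h0 : surfaceEq I J S T M = 0 :=
    (mem_blowSurface_iff hIJ hI hJ hS hT hM).1 (hx ▸ hr ▸ mem_range_self x)
  obtain ⟨c, hc0, hc, hcd⟩ := exists_curve_deriv_ne_zero hIJ hS hT hM h0
  set F : ThreeTorus → ℝ := fun y =>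
    surfaceEq I J (spanning S y.1) (spanning T y.2.1) (spanning M y.2.2) with hF
  have hFs : ContMDiff ((𝓡 1).prod ((𝓡 1).prod (𝓡 1))) 𝓘(ℝ, ℝ) ∞ F :=
    (contDiff_surfaceEq I J).contMDiff.comp
      (((contMDiff_spanning S).comp contMDiff_fst).prodMk_space
        (((contMDiff_spanning T).comp (contMDiff_fst.comp contMDiff_snd)).prodMk_space
          ((contMDiff_spanning M).comp (contMDiff_snd.comp contMDiff_snd))))
  obtain ⟨e, he1, he2, he3, he4⟩ := exists_straightening_chart _ hdim hFs hc hcd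
  -- the three lines may turn by less than a right angle
  set U : Set ThreeTorus := {y | y.1 ≠ -lineDir S ∧ y.2.1 ≠ -lineDir T ∧ y.2.2 ≠ -lineDir M}
  have hU : IsOpen U :=
    (isOpen_ne.preimage continuous_fst).inter
      ((isOpen_ne.preimage (continuous_fst.comp continuous_snd)).inter
        (isOpen_ne.preimage (continuous_snd.comp continuous_snd)))
  have hxU : f x ∈ U := by
    rw [hx]
    exact ⟨fun h => Circle.neg_ne_self _ h.symm, fun h => Circle.neg_ne_self _ h.symm,
      fun h => Circle.neg_ne_self _ h.symm⟩
  refine ⟨e.restrOpen U hU, ⟨by rw [hx, ← hc0]; exact he1, hxU⟩, he2.mono inter_subset_left,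
    he3.mono fun y hy => hy.1, fun y hy => ?_⟩
  have hS1 := spanning_ne_zero hS hy.2.1
  have hT1 := spanning_ne_zero hT hy.2.2.1
  have hM1 := spanning_ne_zero hM hy.2.2.2
  have hy' : y = (lineDir (spanning S y.1), lineDir (spanning T y.2.1),
      lineDir (spanning M y.2.2)) := by
    rw [← (onLine_spanning hS _).eq_lineDir hS1, ← (onLine_spanning hT _).eq_lineDir hT1,
      ← (onLine_spanning hM _).eq_lineDir hM1]
  rw [hr]
  refine Iff.trans ?_ (Iff.of_eq (congrArg (· = 0) (he4 y hy.1).symm))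
  conv_lhs => rw [hy']
  exact mem_blowSurface_iff hIJ hI hJ hS1 hT1 hM1

/-! ### Twisting a collar of the disc -/

/-- The radius-preserving map of the plane that acts on each circle about `0` by the Möbius
transformation `u ↦ (p u + q) / (q̄ u + p̄)` of the unit circle. -/
noncomputable def circleMobius (p q w : ℂ) : ℂ :=
  ‖w‖ * (p * w + q * ‖w‖) / (conj q * w + conj p * ‖w‖)

/-- The pole of the Möbius transformation is not on the unit circle. -/
theorem circleMobius_den_ne_zero {p q w : ℂ} (h : ‖q‖ < ‖p‖) (hw : w ≠ 0) :
    conj q * w + conj p * ‖w‖ ≠ 0 := by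
  intro h0
  have h1 : ‖conj q * w‖ = ‖conj p * (‖w‖ : ℂ)‖ := by
    rw [← norm_neg, eq_neg_of_add_eq_zero_left h0, neg_neg]
  simp only [norm_mul, RCLike.norm_conj, Complex.norm_real, norm_norm] at h1
  exact h.ne (mul_right_cancel₀ (norm_ne_zero_iff.2 hw) h1)

theorem mul_conj_eq_norm_sq (w : ℂ) : w * conj w = ‖w‖ * ‖w‖ := by
  rw [Complex.mul_conj, Complex.normSq_eq_norm_sq]; push_cast; ring

theorem norm_circleMobius {p q : ℂ} (h : ‖q‖ < ‖p‖) (w : ℂ) : ‖circleMobius p q w‖ = ‖w‖ := by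
  by_cases hw : w = 0
  · simp [circleMobius, hw]
  have hd := circleMobius_den_ne_zero h hw
  have h1 : conj (p * w + q * ‖w‖) * w = ‖w‖ * (conj q * w + conj p * ‖w‖) := by
    simp only [map_add, map_mul, Complex.conj_ofReal]
    linear_combination conj p * mul_conj_eq_norm_sq w
  have h2 := congrArg norm h1
  simp only [norm_mul, RCLike.norm_conj, Complex.norm_real, norm_norm] at h2
  have h3 : ‖p * w + q * ‖w‖‖ = ‖conj q * w + conj p * ‖w‖‖ :=
    mul_right_cancel₀ (norm_ne_zero_iff.2 hw) (h2.trans (mul_comm _ _))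
  unfold circleMobius
  rw [norm_div, norm_mul, Complex.norm_real, norm_norm, h3, mul_div_assoc,
    div_self (norm_ne_zero_iff.2 hd), mul_one]

theorem circleMobius_inv {p q : ℂ} (h : ‖q‖ < ‖p‖) (w : ℂ) :
    circleMobius (conj p) (-q) (circleMobius p q w) = w := by
  by_cases hw : w = 0
  · simp [circleMobius, hw]
  have hd := circleMobius_den_ne_zero h hw
  have hw' : (‖w‖ : ℂ) ≠ 0 := by simpa using hw
  have hpq : p * conj p - q * conj q ≠ 0 := by
    rw [mul_conj_eq_norm_sq, mul_conj_eq_norm_sq]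
    norm_cast
    nlinarith [norm_nonneg q]
  have e : circleMobius (conj p) (-q) (circleMobius p q w) =
      ‖w‖ * (conj p * circleMobius p q w + (-q) * ‖w‖) /
        (conj (-q) * circleMobius p q w + conj (conj p) * ‖w‖) := by
    rw [circleMobius, norm_circleMobius h]
  rw [e, Complex.conj_conj]
  set d := conj q * w + conj p * ‖w‖ with hdef
  have hx : circleMobius p q w = ‖w‖ * (p * w + q * ‖w‖) / d := rfl
  have e1 : conj p * circleMobius p q w + (-q) * ‖w‖ =
      ‖w‖ * ((p * conj p - q * conj q) * w) / d := by
    rw [hx]; field_simp; rw [hdef]; ring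
  have e2 : conj (-q) * circleMobius p q w + p * ‖w‖ =
      ‖w‖ * ((p * conj p - q * conj q) * ‖w‖) / d := by
    rw [hx, map_neg]; field_simp; rw [hdef]; ring
  rw [e1, e2]
  field_simp

/-- A Möbius transformation of the unit circle extends to a homeomorphism of the plane that
preserves the distance from `0` and is the identity on a smaller disc. -/
theorem exists_collar_twist {p q : ℂ} (hp : 0 ≤ p.re) (h : ‖q‖ < ‖p‖) :
    ∃ T : ℂ → ℂ, Continuous T ∧ Function.Bijective T ∧ (∀ w, ‖T w‖ = ‖w‖) ∧
      (∀ w, ‖w‖ ≤ 3 / 4 → T w = w) ∧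
      ∀ u, ‖u‖ = 1 → T u = (p * u + q) / (conj q * u + conj p) := by
  -- the cut-off function, equal to `0` for `‖w‖ ≤ 3 / 4` and to `1` for `1 ≤ ‖w‖`
  let s : ℂ → ℝ := fun w => max 0 (min 1 (4 * ‖w‖ - 3))
  have hs0 : ∀ w, 0 ≤ s w := fun w => le_max_left _ _
  have hs1 : ∀ w, s w ≤ 1 := fun w => max_le zero_le_one (min_le_left _ _)
  let P : ℂ → ℂ := fun w => (1 - s w : ℝ) + s w * p
  let Q : ℂ → ℂ := fun w => s w * q
  -- the segment from the identity to `(p, q)` stays among the Möbius transformations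
  have hPQ : ∀ w, ‖Q w‖ < ‖P w‖ := by
    intro w
    have h1 := hs0 w
    have h2 := hs1 w
    have hq : ‖Q w‖ = s w * ‖q‖ := by simp [Q, abs_of_nonneg h1]
    have hP : ‖P w‖ ^ 2 = (1 - s w) ^ 2 + 2 * (1 - s w) * s w * p.re + s w ^ 2 * ‖p‖ ^ 2 := by
      rw [← Complex.normSq_eq_norm_sq, ← Complex.normSq_eq_norm_sq, Complex.normSq_apply,
        Complex.normSq_apply]
      simp only [P, Complex.add_re, Complex.add_im, Complex.ofReal_re, Complex.ofReal_im,
        Complex.re_ofReal_mul, Complex.im_ofReal_mul]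
      ring
    have hn := norm_nonneg q
    refine lt_of_pow_lt_pow_left₀ 2 (norm_nonneg _) ?_
    rw [hq, hP]
    have h3 : 0 ≤ (1 - s w) * s w * p.re := mul_nonneg (mul_nonneg (by linarith) h1) hp
    have h4 : ‖q‖ ^ 2 < ‖p‖ ^ 2 := by nlinarith
    rcases h1.eq_or_lt with h0 | h0
    · rw [← h0]; norm_num
    · have : s w ^ 2 * ‖q‖ ^ 2 < s w ^ 2 * ‖p‖ ^ 2 := mul_lt_mul_of_pos_left h4 (by positivity)
      nlinarith [sq_nonneg (1 - s w)]
  have hsn : ∀ {w w' : ℂ}, ‖w‖ = ‖w'‖ → s w = s w' := fun e => by simp only [s, e]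
  let T : ℂ → ℂ := fun w => circleMobius (P w) (Q w) w
  let T' : ℂ → ℂ := fun w => circleMobius (conj (P w)) (-Q w) w
  have hPQ' : ∀ w, ‖-Q w‖ < ‖conj (P w)‖ := fun w => by simpa using hPQ w
  have hT : ∀ w, ‖T w‖ = ‖w‖ := fun w => norm_circleMobius (hPQ w) w
  have hT' : ∀ w, ‖T' w‖ = ‖w‖ := fun w => norm_circleMobius (hPQ' w) w
  have hl : ∀ w, T' (T w) = w := by
    intro w
    have : s (T w) = s w := hsn (hT w)
    simp only [T', P, Q, this]
    exact circleMobius_inv (hPQ w) w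
  have hr : ∀ w, T (T' w) = w := by
    intro w
    have e : s (T' w) = s w := hsn (hT' w)
    have := circleMobius_inv (hPQ' w) w
    rw [Complex.conj_conj, neg_neg] at this
    simp only [T, P, Q, e]
    exact this
  have hid : ∀ w, ‖w‖ ≤ 3 / 4 → T w = w := by
    intro w hw
    have : s w = 0 := by
      simp only [s]
      rw [max_eq_left ((min_le_right _ _).trans (by linarith))]
    simp only [T, P, Q, this, circleMobius]
    by_cases h0 : w = 0
    · simp [h0]
    · have : (‖w‖ : ℂ) ≠ 0 := by simpa using h0
      simp; field_simp
  have hsc : Continuous s := by fun_prop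
  refine ⟨T, ?_, ⟨Function.LeftInverse.injective hl, Function.RightInverse.surjective hr⟩, hT,
    hid, ?_⟩
  · rw [continuous_iff_continuousAt]
    intro w
    by_cases hw : w = 0
    · refine continuousAt_id.congr ?_
      have : Metric.ball (0 : ℂ) (3 / 4) ∈ 𝓝 w := hw ▸ Metric.ball_mem_nhds _ (by norm_num)
      filter_upwards [this] with x hx
      exact (hid x (by simpa using (Metric.mem_ball.1 hx).le)).symm
    · refine ContinuousAt.div (Continuous.continuousAt ?_) (Continuous.continuousAt ?_)
        (circleMobius_den_ne_zero (hPQ w) hw)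
      · fun_prop
      · simp only [P, Q, map_mul, map_add, Complex.conj_ofReal]; fun_prop
  · intro u hu
    have : s u = 1 := by simp only [s, hu]; norm_num
    simp [T, P, Q, this, circleMobius, hu]

/-! ### Blowing down a punctured projective plane -/

/-- The affine contractions that carry the disc to the nested discs about the blown-up points. -/
noncomputable def nestMap (n : ℕ) (z : ℂ) : ℂ :=
  ⟨blowPt n + (-4 / 21) ^ n * z.re, (4 / 21) ^ n * z.im⟩

theorem nestMap_nestMap (n k : ℕ) (z : ℂ) : nestMap n (nestMap k z) = nestMap (n + k) z := by
  apply Complex.ext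
  · simp only [nestMap, blowPt]; ring
  · simp only [nestMap]; ring

theorem nestMap_zero (z : ℂ) : nestMap 0 z = z := by
  apply Complex.ext <;> simp [nestMap, blowPt]

theorem nestMap_injective (n : ℕ) : Function.Injective (nestMap n) := by
  intro z w h
  have h1 := congrArg Complex.re h
  have h2 := congrArg Complex.im h
  simp only [nestMap, add_right_inj] at h1 h2
  exact Complex.ext (mul_left_cancel₀ (pow_ne_zero _ (by norm_num)) h1)
    (mul_left_cancel₀ (pow_ne_zero _ (by norm_num)) h2)

theorem norm_nestMap_one_sub (z : ℂ) : ‖nestMap 1 z - 10 / 21‖ = 4 / 21 * ‖z‖ := by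
  have : nestMap 1 z - 10 / 21 = (-4 / 21 : ℝ) * conj z := by
    apply Complex.ext
    · rw [Complex.re_ofReal_mul]; simp [nestMap, blowPt]; norm_num
    · rw [Complex.im_ofReal_mul]; simp [nestMap, blowPt]; ring
  rw [this, norm_mul, RCLike.norm_conj, Complex.norm_real]
  norm_num

theorem exists_nestMap_one_eq (w : ℂ) : ∃ z, nestMap 1 z = w ∧ ‖w - 10 / 21‖ = 4 / 21 * ‖z‖ := by
  have : nestMap 1 ⟨5 / 2 - 21 / 4 * w.re, 21 / 4 * w.im⟩ = w := by
    apply Complex.ext <;> simp [nestMap, blowPt] <;> ring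
  exact ⟨_, this, by rw [← norm_nestMap_one_sub, this]⟩

/-- The disc about `10 / 21` of radius `4 / 21`, the image of `nestMap 1`, is well inside the unit
disc. -/
theorem norm_lt_of_near {w : ℂ} (h : ‖w - 10 / 21‖ ≤ 4 / 21) : ‖w‖ < 3 / 4 := by
  have h1 : ‖w‖ ≤ ‖w - 10 / 21‖ + ‖(10 / 21 : ℂ)‖ := by
    simpa using norm_add_le (w - 10 / 21) (10 / 21)
  norm_num at h1
  linarith

namespace ProjectivePlane

/-- Together with `blowH`, linear coordinates in which the disc `A` is the round cone
`|N| < |H|`. -/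
noncomputable def blowN (v : Fin 3 → ℝ) : ℂ := ⟨2 * v 0 + v 2 / 2, √3 * v 1⟩

/-- A linear form whose zero line avoids the discs `A` and `B`. -/
def blowH (v : Fin 3 → ℝ) : ℝ := v 0 + v 2

/-- The map from the projective plane without the disc `A` to the closed unit disc that contracts
the line `blowH = 0` to `0`: inversion in the unit circle of the affine chart `N / H`. -/
noncomputable def contraction (v : Fin 3 → ℝ) : ℂ :=
  (blowH v / Complex.normSq (blowN v) : ℝ) * blowN v

theorem normSq_blowN (v : Fin 3 → ℝ) :
    Complex.normSq (blowN v) = (2 * v 0 + v 2 / 2) ^ 2 + 3 * v 1 ^ 2 := by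
  have := Real.mul_self_sqrt (show (0 : ℝ) ≤ 3 by norm_num)
  rw [blowN, Complex.normSq_mk]; linear_combination v 1 ^ 2 * this

theorem normSq_blowN_sub (v : Fin 3 → ℝ) :
    Complex.normSq (blowN v) - blowH v ^ 2 = 3 / 4 * formA v := by
  rw [normSq_blowN, blowH, formA]; ring

/-- The forms `blowN` and `blowH` determine homogeneous coordinates. -/
theorem eq_of_blow_eq {v w : Fin 3 → ℝ} {c : ℝ} (hN : blowN w = c * blowN v)
    (hH : blowH w = c * blowH v) : w = c • v := by
  have h1 := congrArg Complex.re hN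
  have h2 := congrArg Complex.im hN
  rw [Complex.re_ofReal_mul] at h1
  rw [Complex.im_ofReal_mul] at h2
  simp only [blowN, blowH] at h1 h2 hH
  have h3 : (√3 : ℝ) ≠ 0 := by positivity
  ext i
  fin_cases i
  · simp; linear_combination (2 / 3) * h1 - (1 / 3) * hH
  · simp; exact mul_left_cancel₀ h3 (by linear_combination h2)
  · simp; linear_combination (4 / 3) * hH - (2 / 3) * h1

theorem exists_blow_eq (N : ℂ) (H : ℝ) : ∃ v, blowN v = N ∧ blowH v = H := by
  have h3 : (√3 : ℝ) ≠ 0 := by positivity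
  refine ⟨![(2 * N.re - H) / 3, N.im / √3, H - (2 * N.re - H) / 3], Complex.ext ?_ ?_, ?_⟩
  · simp [blowN]; ring
  · simp [blowN]; field_simp
  · simp [blowH]

theorem blowN_smul (a : ℝ) (v : Fin 3 → ℝ) : blowN (a • v) = a * blowN v := by
  apply Complex.ext
  · rw [Complex.re_ofReal_mul]; simp [blowN]; ring
  · rw [Complex.im_ofReal_mul]; simp [blowN]; ring

theorem contraction_smul {a : ℝ} (ha : a ≠ 0) (v : Fin 3 → ℝ) :
    contraction (a • v) = contraction v := by
  unfold contraction
  rw [blowN_smul, map_mul, Complex.normSq_ofReal, show blowH (a • v) = a * blowH v by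
    simp [blowH]; ring]
  by_cases h : Complex.normSq (blowN v) = 0
  · simp [h]
  · have h' : (Complex.normSq (blowN v) : ℂ) ≠ 0 := by exact_mod_cast h
    have ha' : (a : ℂ) ≠ 0 := by exact_mod_cast ha
    push_cast
    field_simp

theorem blowN_ne_zero {v : Fin 3 → ℝ} (hv : v ≠ 0) (h : 0 ≤ formA v) : blowN v ≠ 0 := by
  intro h0
  have h1 := normSq_blowN_sub v
  rw [h0, map_zero] at h1
  have h2 : blowH v = 0 := by nlinarith [sq_nonneg (blowH v)]
  apply hv
  have := eq_of_blow_eq (v := v) (w := v) (c := 0) (by simp [h0]) (by simp [h2])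
  simpa using this

theorem normSq_contraction {v : Fin 3 → ℝ} (h : blowN v ≠ 0) :
    Complex.normSq (contraction v) = 1 - 3 / 4 * formA v / Complex.normSq (blowN v) := by
  have h' : Complex.normSq (blowN v) ≠ 0 := by simpa using h
  unfold contraction
  rw [map_mul, Complex.normSq_ofReal, ← normSq_blowN_sub]
  field_simp; ring

/-- The map `contraction` carries the disc `B` to the round disc of radius `4 / 21` about `10 / 21`. -/
theorem normSq_contraction_sub {v : Fin 3 → ℝ} (h : blowN v ≠ 0) :
    Complex.normSq (contraction v - 10 / 21) =
      (4 / 21) ^ 2 + formB v / (7 * Complex.normSq (blowN v)) := by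
  have h' : Complex.normSq (blowN v) ≠ 0 := by simpa using h
  have e1 : Complex.normSq (contraction v - 10 / 21) =
      Complex.normSq (contraction v) - 20 / 21 * (contraction v).re + 100 / 441 := by
    rw [Complex.normSq_apply, Complex.normSq_apply]
    simp
    ring
  rw [e1, normSq_contraction h]
  have e2 : (contraction v).re =
      blowH v / Complex.normSq (blowN v) * (2 * v 0 + v 2 / 2) := by
    rw [contraction, Complex.re_ofReal_mul]; rfl
  rw [e2]
  have e3 := normSq_blowN v
  field_simp
  rw [e3, formA, formB, blowH]
  ring

theorem norm_contraction_le {v : Fin 3 → ℝ} (hv : v ≠ 0) (h : 0 ≤ formA v) :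
    ‖contraction v‖ ≤ 1 := by
  have hN := blowN_ne_zero hv h
  have h1 := normSq_contraction hN
  rw [Complex.normSq_eq_norm_sq] at h1
  have : 0 ≤ 3 / 4 * formA v / Complex.normSq (blowN v) :=
    div_nonneg (by linarith) (Complex.normSq_nonneg _)
  nlinarith [norm_nonneg (contraction v)]

theorem norm_contraction_eq_one_iff {v : Fin 3 → ℝ} (h : blowN v ≠ 0) :
    ‖contraction v‖ = 1 ↔ formA v = 0 := by
  have h1 := normSq_contraction h
  have h' : Complex.normSq (blowN v) ≠ 0 := by simpa using h
  rw [Complex.normSq_eq_norm_sq] at h1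
  constructor
  · intro e
    rw [e] at h1
    field_simp at h1
    linarith
  · intro e
    rw [e] at h1
    have : ‖contraction v‖ ^ 2 = 1 ^ 2 := by rw [h1]; simp
    exact (sq_eq_sq₀ (norm_nonneg _) zero_le_one).1 this

theorem norm_contraction_sub_lt_iff {v : Fin 3 → ℝ} (h : blowN v ≠ 0) :
    ‖contraction v - 10 / 21‖ < 4 / 21 ↔ formB v < 0 := by
  have h1 := normSq_contraction_sub h
  have h' : 0 < 7 * Complex.normSq (blowN v) := by
    have := Complex.normSq_pos.2 h; linarith
  rw [Complex.normSq_eq_norm_sq] at h1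
  rw [← sq_lt_sq₀ (norm_nonneg _) (by norm_num), h1, add_lt_iff_neg_left, div_lt_iff₀ h', zero_mul]

theorem norm_contraction_sub_le_iff {v : Fin 3 → ℝ} (h : blowN v ≠ 0) :
    ‖contraction v - 10 / 21‖ ≤ 4 / 21 ↔ formB v ≤ 0 := by
  have h1 := normSq_contraction_sub h
  have h' : 0 < 7 * Complex.normSq (blowN v) := by
    have := Complex.normSq_pos.2 h; linarith
  rw [Complex.normSq_eq_norm_sq] at h1
  rw [← sq_le_sq₀ (norm_nonneg _) (by norm_num), h1, add_le_iff_nonpos_right, div_le_iff₀ h',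
    zero_mul]

end ProjectivePlane

/-! ### The twisted contraction -/

/-- A homeomorphism of the plane, preserving the distance from `0` and fixing a disc that contains
the image of the disc `B` under `contraction`. -/
structure IsTwist (T : ℂ → ℂ) : Prop where
  continuous : Continuous T
  bijective : Function.Bijective T
  norm_eq : ∀ w, ‖T w‖ = ‖w‖
  eq_self : ∀ w, ‖w‖ ≤ 3 / 4 → T w = w

theorem IsTwist.eq_zero_iff {T : ℂ → ℂ} (hT : IsTwist T) {w : ℂ} : T w = 0 ↔ w = 0 := by
  rw [← norm_eq_zero, hT.norm_eq, norm_eq_zero]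

theorem IsTwist.eq_of_near {T : ℂ → ℂ} (hT : IsTwist T) {w : ℂ} (h : ‖w - 10 / 21‖ ≤ 4 / 21) :
    T w = w := hT.eq_self w (norm_lt_of_near h).le

theorem IsTwist.near_iff {T : ℂ → ℂ} (hT : IsTwist T) {w : ℂ} :
    ‖T w - 10 / 21‖ ≤ 4 / 21 ↔ ‖w - 10 / 21‖ ≤ 4 / 21 := by
  refine ⟨fun h => ?_, fun h => by rwa [hT.eq_of_near h]⟩
  have h1 := norm_lt_of_near h
  rw [hT.norm_eq] at h1
  rwa [hT.eq_self w h1.le] at h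

theorem IsTwist.near_iff' {T : ℂ → ℂ} (hT : IsTwist T) {w : ℂ} :
    ‖T w - 10 / 21‖ < 4 / 21 ↔ ‖w - 10 / 21‖ < 4 / 21 := by
  refine ⟨fun h => ?_, fun h => by rwa [hT.eq_of_near h.le]⟩
  rwa [hT.eq_of_near (hT.near_iff.1 h.le)] at h

namespace ProjectivePlane

variable {T : ℂ → ℂ}

/-- The twisted contraction of the complement of the disc `A` to the closed unit disc. -/
noncomputable def blowDown (T : ℂ → ℂ) (p : ProjectivePlane) : ℂ := T (contraction (coords p))

/-- A vector along `blowDown T p`, or along the direction of `p` as a point of the blown-up disc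
if `p` is on the contracted line. -/
noncomputable def blowDir (T : ℂ → ℂ) (p : ProjectivePlane) : ℂ :=
  if contraction (coords p) = 0 then blowN (coords p) else T (contraction (coords p))

theorem blowDown_mk (T : ℂ → ℂ) {v : Fin 3 → ℝ} (hv : v ≠ 0) :
    blowDown T (mk v hv) = T (contraction v) := by
  obtain ⟨a, ha, h⟩ := exists_coords_mk v hv
  rw [blowDown, h, contraction_smul ha]

theorem blowDir_mk_of_ne (T : ℂ → ℂ) {v : Fin 3 → ℝ} (hv : v ≠ 0) (h0 : contraction v ≠ 0) :
    blowDir T (mk v hv) = T (contraction v) := by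
  obtain ⟨a, ha, h⟩ := exists_coords_mk v hv
  rw [blowDir, h, contraction_smul ha, if_neg h0]

theorem exists_blowDir_mk_of_eq (T : ℂ → ℂ) {v : Fin 3 → ℝ} (hv : v ≠ 0) (h0 : contraction v = 0) :
    ∃ a : ℝ, a ≠ 0 ∧ blowDir T (mk v hv) = a * blowN v := by
  obtain ⟨a, ha, h⟩ := exists_coords_mk v hv
  exact ⟨a, ha, by rw [blowDir, h, contraction_smul ha, if_pos h0, blowN_smul]⟩

theorem contraction_eq_zero_iff {v : Fin 3 → ℝ} (h : blowN v ≠ 0) :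
    contraction v = 0 ↔ blowH v = 0 := by
  simp [contraction, h]

theorem blowDir_ne_zero (hT : IsTwist T) {v : Fin 3 → ℝ} (hv : v ≠ 0) (h : 0 ≤ formA v) :
    blowDir T (mk v hv) ≠ 0 := by
  by_cases h0 : contraction v = 0
  · obtain ⟨a, ha, e⟩ := exists_blowDir_mk_of_eq T hv h0
    rw [e]
    exact mul_ne_zero (by exact_mod_cast ha) (blowN_ne_zero hv h)
  · rwa [blowDir_mk_of_ne T hv h0, ne_eq, hT.eq_zero_iff]

theorem blowDown_eq_blowDir (hT : IsTwist T) (p : ProjectivePlane) (h : blowDown T p ≠ 0) :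
    blowDir T p = blowDown T p := by
  unfold blowDown at *
  rw [blowDir, if_neg (fun h0 => h (hT.eq_zero_iff.2 h0))]

theorem norm_blowDown_le (hT : IsTwist T) {v : Fin 3 → ℝ} (hv : v ≠ 0) (h : 0 ≤ formA v) :
    ‖blowDown T (mk v hv)‖ ≤ 1 := by
  rw [blowDown_mk, hT.norm_eq]; exact norm_contraction_le hv h

theorem norm_blowDown_eq_one_iff (hT : IsTwist T) {v : Fin 3 → ℝ} (hv : v ≠ 0)
    (h : 0 ≤ formA v) : ‖blowDown T (mk v hv)‖ = 1 ↔ formA v = 0 := by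
  rw [blowDown_mk, hT.norm_eq]; exact norm_contraction_eq_one_iff (blowN_ne_zero hv h)

theorem blowDown_sub_lt_iff (hT : IsTwist T) {v : Fin 3 → ℝ} (hv : v ≠ 0)
    (h : 0 ≤ formA v) : ‖blowDown T (mk v hv) - 10 / 21‖ < 4 / 21 ↔ formB v < 0 := by
  rw [blowDown_mk, hT.near_iff']; exact norm_contraction_sub_lt_iff (blowN_ne_zero hv h)

theorem blowDown_sub_le_iff (hT : IsTwist T) {v : Fin 3 → ℝ} (hv : v ≠ 0)
    (h : 0 ≤ formA v) : ‖blowDown T (mk v hv) - 10 / 21‖ ≤ 4 / 21 ↔ formB v ≤ 0 := by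
  rw [blowDown_mk, hT.near_iff]; exact norm_contraction_sub_le_iff (blowN_ne_zero hv h)

/-- The complement of the disc `A` is mapped injectively to the blown-up disc. -/
theorem eq_of_blowDown_eq (hT : IsTwist T) {v w : Fin 3 → ℝ} (hv : v ≠ 0) (hw : w ≠ 0)
    (hv' : 0 ≤ formA v) (hw' : 0 ≤ formA w)
    (h : blowDown T (mk v hv) = blowDown T (mk w hw))
    (h' : lineDir (blowDir T (mk v hv)) = lineDir (blowDir T (mk w hw))) :
    mk v hv = mk w hw := by
  have hNv := blowN_ne_zero hv hv'
  have hNw := blowN_ne_zero hw hw'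
  have hnv : Complex.normSq (blowN v) ≠ 0 := by simpa using hNv
  have hnw : Complex.normSq (blowN w) ≠ 0 := by simpa using hNw
  rw [blowDown_mk, blowDown_mk] at h
  have hc := hT.bijective.1 h
  suffices ∃ c : ℝ, blowN w = c * blowN v ∧ blowH w = c * blowH v by
    obtain ⟨c, h1, h2⟩ := this
    refine mk_eq_mk_iff.2 ⟨c, ?_, eq_of_blow_eq h1 h2⟩
    rintro rfl
    exact hNw (by simpa using h1)
  by_cases h0 : contraction v = 0
  · have h1 : contraction w = 0 := hc ▸ h0
    obtain ⟨a, ha, ea⟩ := exists_blowDir_mk_of_eq T hv h0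
    obtain ⟨b, hb, eb⟩ := exists_blowDir_mk_of_eq T hw h1
    rw [ea, eb, lineDir_real_mul ha, lineDir_real_mul hb] at h'
    obtain ⟨c, hc⟩ := exists_real_mul_of_onLine (onLine_lineDir (blowN v))
      (h' ▸ onLine_lineDir (blowN w)) hNv
    refine ⟨c, hc, ?_⟩
    rw [(contraction_eq_zero_iff hNv).1 h0, (contraction_eq_zero_iff hNw).1 h1, mul_zero]
  · have hHv : blowH v ≠ 0 := fun e => h0 ((contraction_eq_zero_iff hNv).2 e)
    have hHw : blowH w ≠ 0 := fun e => h0 (hc ▸ (contraction_eq_zero_iff hNw).2 e)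
    have e1 : (blowH v / Complex.normSq (blowN v) : ℝ) * blowN v =
      (blowH w / Complex.normSq (blowN w) : ℝ) * blowN w := hc
    obtain ⟨c, hcc⟩ : ∃ c : ℝ, blowN w = c * blowN v := by
      refine ⟨(blowH w / Complex.normSq (blowN w))⁻¹ * (blowH v / Complex.normSq (blowN v)), ?_⟩
      have : ((blowH w / Complex.normSq (blowN w) : ℝ) : ℂ) ≠ 0 := by
        exact_mod_cast div_ne_zero hHw hnw
      rw [Complex.ofReal_mul, mul_assoc, e1, ← mul_assoc, Complex.ofReal_inv,
        inv_mul_cancel₀ this, one_mul]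
    refine ⟨c, hcc, ?_⟩
    have hc0 : c ≠ 0 := by rintro rfl; exact hNw (by simpa using hcc)
    rw [hcc, map_mul, Complex.normSq_ofReal, ← mul_assoc, ← Complex.ofReal_mul] at e1
    have e2 := Complex.ofReal_injective (mul_right_cancel₀ hNv e1)
    field_simp at e2
    linarith

/-- The complement of the disc `A` covers the blown-up disc. -/
theorem exists_blowDown_eq (hT : IsTwist T) {z d : ℂ} (hd : d ≠ 0) (hz : ‖z‖ ≤ 1) {a : ℝ}
    (ha : z = a * d) : ∃ (v : Fin 3 → ℝ) (hv : v ≠ 0), 0 ≤ formA v ∧ blowDown T (mk v hv) = z ∧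
      lineDir (blowDir T (mk v hv)) = lineDir d := by
  obtain ⟨y, rfl⟩ := hT.bijective.2 z
  rw [hT.norm_eq] at hz
  by_cases h0 : y = 0
  · obtain ⟨v, hN, hH⟩ := exists_blow_eq d 0
    have hv : v ≠ 0 := by
      rintro rfl; apply hd; rw [← hN]; apply Complex.ext <;> simp [blowN]
    have hA : 0 ≤ formA v := by
      have := normSq_blowN_sub v
      rw [hH] at this
      nlinarith [Complex.normSq_nonneg (blowN v)]
    have hc : contraction v = 0 := by rw [contraction, hH]; simp
    obtain ⟨b, hb, e⟩ := exists_blowDir_mk_of_eq T hv hc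
    exact ⟨v, hv, hA, by rw [blowDown_mk, hc, h0], by rw [e, lineDir_real_mul hb, hN]⟩
  · obtain ⟨v, hN, hH⟩ := exists_blow_eq y (Complex.normSq y)
    have hv : v ≠ 0 := by
      rintro rfl; apply h0; rw [← hN]; apply Complex.ext <;> simp [blowN]
    have hA : 0 ≤ formA v := by
      have h1 := normSq_blowN_sub v
      rw [hH, hN, Complex.normSq_eq_norm_sq] at h1
      have h2 : ‖y‖ ^ 2 ≤ 1 := by nlinarith [norm_nonneg y]
      nlinarith [sq_nonneg ‖y‖]
    have hn : Complex.normSq y ≠ 0 := by simpa using h0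
    have hc : contraction v = y := by rw [contraction, hH, hN, div_self hn]; simp
    refine ⟨v, hv, hA, by rw [blowDown_mk, hc], ?_⟩
    rw [blowDir_mk_of_ne T hv (by rwa [hc]), hc, ha, lineDir_real_mul]
    rintro rfl
    exact h0 (hT.eq_zero_iff.1 (by simpa using ha))

theorem continuous_blowN : Continuous blowN := by
  have : blowN = fun v => ((2 * v 0 + v 2 / 2 : ℝ) : ℂ) + (√3 * v 1 : ℝ) * Complex.I := by
    ext v
    apply Complex.ext
    · simp only [Complex.add_re, Complex.ofReal_re, Complex.re_ofReal_mul, Complex.I_re]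
      simp [blowN]
    · simp only [Complex.add_im, Complex.ofReal_im, Complex.im_ofReal_mul, Complex.I_im]
      simp [blowN]
  rw [this]
  fun_prop

theorem continuousAt_contraction {v : Fin 3 → ℝ} (h : blowN v ≠ 0) :
    ContinuousAt contraction v := by
  have hn : Complex.normSq (blowN v) ≠ 0 := by simpa using h
  have hH : Continuous blowH := by unfold blowH; fun_prop
  refine ContinuousAt.mul (Complex.continuous_ofReal.continuousAt.comp ?_)
    continuous_blowN.continuousAt
  exact hH.continuousAt.div (Complex.continuous_normSq.comp continuous_blowN).continuousAt hn

/-- A continuous function of points of the blown-up disc, given in terms of vectors spanning the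
directions, is continuous on the projective plane outside the disc `A`. -/
theorem continuousAt_blowDown (hT : IsTwist T) {Y : Type*} [TopologicalSpace Y] {G : ℂ → ℂ → Y}
    (hG : ∀ (z d : ℂ) (a : ℝ), a ≠ 0 → G z (a * d) = G z d) {v : Fin 3 → ℝ} (hv : v ≠ 0)
    (h : 0 ≤ formA v)
    (hc : ContinuousAt (fun x : ℂ × ℂ => G x.1 x.2)
      (blowDown T (mk v hv), blowDir T (mk v hv))) :
    ContinuousAt (fun p => G (blowDown T p) (blowDir T p)) (mk v hv) := by
  have hN := blowN_ne_zero hv h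
  have hcon := continuousAt_contraction hN
  have hTc : ContinuousAt (fun w => T (contraction w)) v :=
    hT.continuous.continuousAt.comp hcon
  by_cases h0 : contraction v = 0
  · obtain ⟨a, ha, e⟩ := exists_blowDir_mk_of_eq T hv h0
    refine continuousAt_of_coords (g' := fun w => G (T (contraction w)) (a * blowN w)) hv ?_ ?_
    · rw [blowDown_mk, e] at hc
      exact ContinuousAt.comp (f := fun w => (T (contraction w), (a : ℂ) * blowN w)) hc
        (hTc.prodMk (continuous_const.mul continuous_blowN).continuousAt)
    · have h1 : ∀ᶠ w in 𝓝 v, ‖contraction w‖ < 3 / 4 :=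
        hcon.norm.eventually_lt continuousAt_const (by rw [h0]; norm_num)
      have h2 : ∀ᶠ w in 𝓝 v, blowN w ≠ 0 :=
        continuous_blowN.continuousAt.eventually_ne hN
      filter_upwards [h1, h2] with w hw hNw hw0
      rw [blowDown_mk, hG _ _ a ha]
      by_cases h3 : contraction w = 0
      · obtain ⟨b, hb, e'⟩ := exists_blowDir_mk_of_eq T hw0 h3
        rw [e', hG _ _ b hb]
      · rw [blowDir_mk_of_ne T hw0 h3, hT.eq_self _ hw.le]
        conv_lhs => rw [show G (contraction w) (contraction w) = G (contraction w)
          ((blowH w / Complex.normSq (blowN w) : ℝ) * blowN w) from rfl]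
        refine hG _ _ _ (div_ne_zero (fun e => h3 ((contraction_eq_zero_iff hNw).2 e)) ?_)
        simpa using hNw
  · refine continuousAt_of_coords (g' := fun w => G (T (contraction w)) (T (contraction w))) hv ?_ ?_
    · rw [blowDown_mk, blowDir_mk_of_ne T hv h0] at hc
      exact ContinuousAt.comp (f := fun w => (T (contraction w), T (contraction w))) hc
        (hTc.prodMk hTc)
    · filter_upwards [hcon.eventually_ne h0] with w hw hw0
      rw [blowDown_mk, blowDir_mk_of_ne T hw0 hw]

/-! ### The boundary circles -/

/-- The parametrization by `z` of the image of the boundary of the disc `B` under `contraction`,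
normalized to the unit circle. -/
noncomputable def seam (z : ℂ) : ℂ := ⟨(11 - 38 * z.im) / (38 - 11 * z.im),
  21 * √3 * z.re / (38 - 11 * z.im)⟩

theorem re_sq_add_im_sq {z : ℂ} (hz : ‖z‖ = 1) : z.re ^ 2 + z.im ^ 2 = 1 := by
  have := Complex.normSq_eq_norm_sq z
  rw [hz, Complex.normSq_apply] at this; linarith

theorem im_le_one {z : ℂ} (hz : ‖z‖ = 1) : z.im ≤ 1 :=
  (Complex.abs_im_le_norm z |> le_trans (le_abs_self _)).trans hz.le

theorem neg_one_le_im {z : ℂ} (hz : ‖z‖ = 1) : -1 ≤ z.im := by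
  have := (neg_abs_le z.im); have := Complex.abs_im_le_norm z; linarith

theorem neg_one_le_re {z : ℂ} (hz : ‖z‖ = 1) : -1 ≤ z.re := by
  have := (neg_abs_le z.re); have := Complex.abs_re_le_norm z; linarith

theorem norm_seam {z : ℂ} (hz : ‖z‖ = 1) : ‖seam z‖ = 1 := by
  have h1 := re_sq_add_im_sq hz
  have h2 : (38 - 11 * z.im) ≠ 0 := by linarith [im_le_one hz]
  have h3 := Real.mul_self_sqrt (show (0 : ℝ) ≤ 3 by norm_num)
  have : ‖seam z‖ ^ 2 = 1 ^ 2 := by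
    rw [← Complex.normSq_eq_norm_sq, seam, Complex.normSq_mk]
    field_simp
    linear_combination 441 * z.re ^ 2 * h3 + 1323 * h1
  exact (sq_eq_sq₀ (norm_nonneg _) zero_le_one).1 this

theorem seam_injOn {z w : ℂ} (hz : ‖z‖ = 1) (hw : ‖w‖ = 1) (h : seam z = seam w) : z = w := by
  have h1 : (38 - 11 * z.im) ≠ 0 := by linarith [im_le_one hz]
  have h2 : (38 - 11 * w.im) ≠ 0 := by linarith [im_le_one hw]
  have h3 : (√3 : ℝ) ≠ 0 := by positivity
  have e1 := congrArg Complex.re h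
  have e2 := congrArg Complex.im h
  simp only [seam] at e1 e2
  rw [div_eq_div_iff h1 h2] at e1 e2
  have e3 : z.im = w.im := by linarith
  refine Complex.ext ?_ e3
  rw [e3] at e2
  have := mul_right_cancel₀ h2 e2
  exact mul_left_cancel₀ (mul_ne_zero (by norm_num) h3) this

theorem blowDown_discB (hT : IsTwist T) {z : ℂ} (hz : ‖z‖ = 1) :
    blowDown T (discB z) = nestMap 1 (seam z) := by
  have hv := vec3_ne_zero_of_zero (b := z.re) (c := z.im) (two_ne_zero (α := ℝ))
  have h1 := re_sq_add_im_sq hz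
  have h2 : (38 - 11 * z.im) ≠ 0 := by linarith [im_le_one hz]
  have h3 : z.im + 2 ≠ 0 := by linarith [neg_one_le_im hz]
  have h4 : √3 ^ 2 = 3 := Real.sq_sqrt (by norm_num)
  have hn : Complex.normSq (blowN ![2, z.re, z.im]) = (z.im + 2) * (38 - 11 * z.im) / 4 := by
    rw [normSq_blowN]; simp; linear_combination 3 * h1
  have hc : contraction ![2, z.re, z.im] = nestMap 1 (seam z) := by
    unfold contraction
    rw [hn]
    apply Complex.ext
    · rw [Complex.re_ofReal_mul]
      simp [blowN, blowH, nestMap, seam, blowPt]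
      rw [add_comm 2 z.im]
      obtain ⟨D, hD⟩ : ∃ D, D = 38 - 11 * z.im := ⟨_, rfl⟩
      rw [← hD] at h2 ⊢
      field_simp
      rw [hD]
      ring
    · rw [Complex.im_ofReal_mul]
      simp [blowN, blowH, nestMap, seam]
      rw [add_comm 2 z.im]
      field_simp
  rw [discB_eq _ hv, blowDown_mk, hc]
  refine hT.eq_of_near ?_
  rw [norm_nestMap_one_sub, norm_seam hz, mul_one]

/-- The effect of `contraction` on the boundary of the disc `A`. -/
theorem contraction_discA {z : ℂ} (hz : ‖z‖ = 1) :
    contraction ![z.re, z.im, 2] = ⟨(2 * z.re + 1) / (z.re + 2), √3 * z.im / (z.re + 2)⟩ := by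
  have h1 := re_sq_add_im_sq hz
  have h3 : z.re + 2 ≠ 0 := by linarith [neg_one_le_re hz]
  have hn : Complex.normSq (blowN ![z.re, z.im, 2]) = (z.re + 2) ^ 2 := by
    rw [normSq_blowN]; simp; linear_combination 3 * h1
  unfold contraction
  rw [hn]
  apply Complex.ext
  · rw [Complex.re_ofReal_mul]; simp [blowN, blowH]; field_simp
  · rw [Complex.im_ofReal_mul]; simp [blowN, blowH]; field_simp

theorem formA_discA_eq_zero {z : ℂ} (hz : ‖z‖ = 1) : formA ![z.re, z.im, 2] = 0 := by
  rw [formA_discA, hz]; norm_num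

/-- A Möbius transformation of the unit circle can be realized by a twist, which changes the
parametrization of the boundary of the disc `A`. -/
theorem exists_twist_discA {p q : ℂ} (hp : 0 ≤ p.re) (h : ‖q‖ < ‖p‖) {g : ℂ → ℂ}
    (hg : ∀ z, ‖z‖ = 1 → ∀ u : ℂ,
      u = ⟨(2 * z.re + 1) / (z.re + 2), √3 * z.im / (z.re + 2)⟩ →
      p * u + q = g z * (conj q * u + conj p)) :
    ∃ T, IsTwist T ∧ ∀ z, ‖z‖ = 1 → blowDown T (discA z) = g z := by
  obtain ⟨T, h1, h2, h3, h4, h5⟩ := exists_collar_twist hp h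
  refine ⟨T, ⟨h1, h2, h3, h4⟩, fun z hz => ?_⟩
  have hv := vec3_ne_zero_of_two (a := z.re) (b := z.im) (two_ne_zero (α := ℝ))
  have hu : ‖contraction ![z.re, z.im, 2]‖ = 1 :=
    (norm_contraction_eq_one_iff (blowN_ne_zero hv (formA_discA_eq_zero hz).ge)).2
      (formA_discA_eq_zero hz)
  have hu0 : contraction ![z.re, z.im, 2] ≠ 0 := norm_ne_zero_iff.1 (by rw [hu]; exact one_ne_zero)
  have hd := circleMobius_den_ne_zero h hu0
  rw [hu, Complex.ofReal_one, mul_one] at hd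
  rw [discA_eq _ hv, blowDown_mk, h5 _ hu, div_eq_iff hd]
  exact hg z hz _ (contraction_discA hz)

/-- The twist of the first blow-up, which makes the boundary of the disc `A` standard. -/
theorem exists_twist_id : ∃ T, IsTwist T ∧ ∀ z, ‖z‖ = 1 → blowDown T (discA z) = z := by
  have h4 : √3 ^ 2 = 3 := Real.sq_sqrt (by norm_num)
  have h0 : (0 : ℝ) < √3 := by positivity
  -- the Möbius transformation inverse to the one in `contraction_discA`
  refine exists_twist_discA (p := (2 + √3 : ℝ)) (q := -1) (by rw [Complex.ofReal_re]; positivity)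
    ?_ ?_
  · rw [norm_neg, norm_one, Complex.norm_real, Real.norm_of_nonneg (by positivity)]
    linarith
  · rintro z hz u rfl
    have h1 := re_sq_add_im_sq hz
    have h3 : z.re + 2 ≠ 0 := by linarith [neg_one_le_re hz]
    apply Complex.ext
    · simp
      field_simp
      linear_combination (-√3) * h1
    · simp
      field_simp
      linear_combination z.im * h4

/-- The twist of the later blow-ups, which makes the boundary of the disc `A` match the boundary
of the disc `B` in the preceding copy. -/
theorem exists_twist_seam : ∃ T, IsTwist T ∧ ∀ z, ‖z‖ = 1 → blowDown T (discA z) = seam z := by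
  have h4 : √3 ^ 2 = 3 := Real.sq_sqrt (by norm_num)
  -- the Möbius transformation of the preceding lemma, followed by `seam`
  refine exists_twist_discA (p := ⟨8, 5 * √3⟩) (q := ⟨-1, -2 * √3⟩) (by norm_num) ?_ ?_
  · rw [← sq_lt_sq₀ (norm_nonneg _) (norm_nonneg _), ← Complex.normSq_eq_norm_sq,
      ← Complex.normSq_eq_norm_sq, Complex.normSq_mk, Complex.normSq_mk]
    nlinarith
  · rintro z hz u rfl
    have h1 := re_sq_add_im_sq hz
    have h2 : (38 - 11 * z.im) ≠ 0 := by linarith [im_le_one hz]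
    have h3 : z.re + 2 ≠ 0 := by linarith [neg_one_le_re hz]
    obtain ⟨D, hD⟩ : ∃ D, D = 38 - 11 * z.im := ⟨_, rfl⟩
    apply Complex.ext
    · simp [seam]
      rw [← hD] at h2 ⊢
      field_simp
      rw [hD]
      linear_combination (-63) * h1 + (-5 * z.im * (38 - 11 * z.im) + 2 * z.im * (11 - 38 * z.im) - 21 * z.re * (z.re + z.im + 8)) * h4
    · simp [seam]
      rw [← hD] at h2 ⊢
      field_simp
      rw [hD]
      linear_combination (-126) * h1 + (42 * z.re * z.im) * h4

end ProjectivePlane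

/-! ### The coordinates resolving the blown-up points -/

/-- At the point `nestMap n z` of the affine plane, blown up at `blowPt n` along the direction of
`d`, a vector in the circle-valued coordinate that resolves the points with indices in `I`. If
`n ∈ I`, it arises from `blowVec` by cancelling the common factor of `z` and `d`. -/
noncomputable def levelVec (I : Finset ℕ) (n : ℕ) (z d : ℂ) : ℂ :=
  if n ∈ I then
    ⟨(4 / 21) ^ n * d.im * qForm I ⟨2, (nestMap n z).re⟩,
      (-4 / 21) ^ n * d.re * (2 * ∏ i ∈ I.erase n, (2 * (nestMap n z).re - blowPt i * 2))⟩
  else blowVec I ⟨2, (nestMap n z).re⟩ 1 (nestMap n z).im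

theorem blowVec_eq_levelVec {I : Finset ℕ} {n : ℕ} (hn : n ∈ I) {z d : ℂ} {t : ℝ}
    (h : z = t * d) :
    blowVec I ⟨2, (nestMap n z).re⟩ 1 (nestMap n z).im = t * levelVec I n z d := by
  have h1 : z.re = t * d.re := by rw [h, Complex.re_ofReal_mul]
  have h2 : z.im = t * d.im := by rw [h, Complex.im_ofReal_mul]
  rw [levelVec, if_pos hn]
  apply Complex.ext
  · rw [Complex.re_ofReal_mul]
    simp only [blowVec, nestMap, h2]; ring
  · rw [Complex.im_ofReal_mul]
    simp only [blowVec, rForm]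
    rw [← Finset.mul_prod_erase I _ hn]
    simp only [nestMap, h1]; ring

theorem onLine_levelVec {I : Finset ℕ} {n : ℕ} {z d : ℂ} {t : ℝ} (h : z = t * d) :
    OnLine (lineDir (levelVec I n z d)) (blowVec I ⟨2, (nestMap n z).re⟩ 1 (nestMap n z).im) := by
  by_cases hn : n ∈ I
  · rw [blowVec_eq_levelVec hn h]
    exact (onLine_lineDir _).real_smul t
  · rw [levelVec, if_neg hn]
    exact onLine_lineDir _

theorem levelVec_self (I : Finset ℕ) (n : ℕ) (z : ℂ) :
    levelVec I n z z = blowVec I ⟨2, (nestMap n z).re⟩ 1 (nestMap n z).im := by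
  by_cases hn : n ∈ I
  · rw [blowVec_eq_levelVec hn (z := z) (d := z) (t := 1) (by simp)]; simp
  · rw [levelVec, if_neg hn]

theorem lineDir_levelVec_mul (I : Finset ℕ) (n : ℕ) (z d : ℂ) {a : ℝ} (ha : a ≠ 0) :
    lineDir (levelVec I n z (a * d)) = lineDir (levelVec I n z d) := by
  by_cases hn : n ∈ I
  · rw [← lineDir_real_mul ha (levelVec I n z d)]
    congr 1
    simp only [levelVec, if_pos hn]
    apply Complex.ext
    · rw [Complex.re_ofReal_mul]; simp; ring
    · rw [Complex.im_ofReal_mul]; simp; ring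
  · simp only [levelVec, if_neg hn]

theorem continuous_mk_complex {X : Type*} [TopologicalSpace X] {f g : X → ℝ} (hf : Continuous f)
    (hg : Continuous g) : Continuous fun x => (⟨f x, g x⟩ : ℂ) := by
  have : (fun x => (⟨f x, g x⟩ : ℂ)) = fun x => (f x : ℂ) + g x * Complex.I := by
    ext x; exact Complex.mk_eq_add_mul_I _ _
  rw [this]
  fun_prop

theorem continuous_nestMap (n : ℕ) : Continuous (nestMap n) := by
  unfold nestMap
  exact continuous_mk_complex (by fun_prop) (by fun_prop)

theorem continuous_qForm (I : Finset ℕ) : Continuous (qForm I) :=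
  Complex.continuous_normSq.pow _

theorem continuous_rForm (I : Finset ℕ) : Continuous (rForm I) :=
  continuous_finsetProd _ fun i _ => by fun_prop

theorem continuous_blowVec (I : Finset ℕ) {X : Type*} [TopologicalSpace X] {S : X → ℂ}
    {f g : X → ℝ} (hS : Continuous S) (hf : Continuous f) (hg : Continuous g) :
    Continuous fun x => blowVec I (S x) (f x) (g x) :=
  continuous_mk_complex (hg.mul ((continuous_qForm I).comp hS))
    (hf.mul ((continuous_rForm I).comp hS))

theorem continuous_levelVec (I : Finset ℕ) (n : ℕ) :
    Continuous fun x : ℂ × ℂ => levelVec I n x.1 x.2 := by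
  have h1 : Continuous fun x : ℂ × ℂ => (nestMap n x.1).re :=
    Complex.continuous_re.comp ((continuous_nestMap n).comp continuous_fst)
  have h2 : Continuous fun x : ℂ × ℂ => (nestMap n x.1).im :=
    Complex.continuous_im.comp ((continuous_nestMap n).comp continuous_fst)
  have h3 : Continuous fun x : ℂ × ℂ => (⟨2, (nestMap n x.1).re⟩ : ℂ) :=
    continuous_mk_complex continuous_const h1
  by_cases hn : n ∈ I
  · simp only [levelVec, if_pos hn]
    refine continuous_mk_complex ?_ ?_
    · exact (by fun_prop : Continuous fun x : ℂ × ℂ => ((4 / 21 : ℝ)) ^ n * x.2.im).mul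
        ((continuous_qForm I).comp h3)
    · refine (by fun_prop : Continuous fun x : ℂ × ℂ => ((-4 / 21 : ℝ)) ^ n * x.2.re).mul
        (continuous_const.mul (continuous_finsetProd _ fun i _ => ?_))
      exact (continuous_const.mul h1).sub continuous_const
  · simp only [levelVec, if_neg hn]
    exact continuous_blowVec I h3 continuous_const h2

/-- The blown-up points in the disc `nestMap n '' closedBall 0 1`, other than `blowPt n`, are in
the next disc. -/
theorem near_of_nestMap_eq_blowPt {n i : ℕ} {z : ℂ} (hz : ‖z‖ ≤ 1) (hi : i ≠ n)
    (h1 : (nestMap n z).re = blowPt i) (h2 : (nestMap n z).im = 0) :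
    n < i ∧ ‖z - 10 / 21‖ < 4 / 21 := by
  have him : z.im = 0 := by
    simpa [nestMap] using h2
  have hre : |z.re| ≤ 1 := (Complex.abs_re_le_norm z).trans hz
  have h3 : (-4 / 21 : ℝ) ^ n * (z.re - 2 / 5) = -2 / 5 * (-4 / 21) ^ i := by
    simp only [nestMap, blowPt] at h1; linear_combination h1
  have hpow : ∀ k : ℕ, |(-4 / 21 : ℝ) ^ (k + 1)| ≤ 4 / 21 := fun k => by
    rw [abs_pow, pow_succ]
    have : |(-4 / 21 : ℝ)| = 4 / 21 := by rw [abs_of_neg] <;> norm_num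
    rw [this]
    have : (4 / 21 : ℝ) ^ k ≤ 1 := pow_le_one₀ (by norm_num) (by norm_num)
    linarith
  rcases lt_or_gt_of_ne hi with h | h
  · exfalso
    obtain ⟨k, rfl⟩ := Nat.exists_eq_add_of_lt h
    rw [add_assoc, pow_add, mul_assoc, mul_comm (-2 / 5 : ℝ)] at h3
    have h4 := mul_left_cancel₀ (pow_ne_zero i (by norm_num)) h3
    have h5 := congrArg abs h4
    rw [abs_mul] at h5
    have h6 := hpow k
    have h7 : |z.re - 2 / 5| ≤ 7 / 5 := by
      rw [abs_le] at hre ⊢; constructor <;> linarith [hre.1, hre.2]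
    have h8 : |(-2 / 5 : ℝ)| = 2 / 5 := by rw [abs_of_neg] <;> norm_num
    rw [h8] at h5
    have := mul_le_mul h6 h7 (abs_nonneg _) (by norm_num)
    linarith
  · refine ⟨h, ?_⟩
    obtain ⟨k, rfl⟩ := Nat.exists_eq_add_of_lt h
    rw [add_assoc, pow_add, mul_left_comm] at h3
    have h4 := mul_left_cancel₀ (pow_ne_zero n (by norm_num)) h3
    have h6 := abs_le.1 (hpow k)
    have h7 : z - 10 / 21 = ((z.re - 10 / 21 : ℝ) : ℂ) := by
      apply Complex.ext <;> simp [him]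
    rw [h7, Complex.norm_real, Real.norm_eq_abs, abs_lt]
    constructor <;> linarith [h6.1, h6.2]

theorem eq_blowPt_of_blowVec_eq_zero {I : Finset ℕ} {a b : ℝ} (h : blowVec I ⟨2, a⟩ 1 b = 0) :
    b = 0 ∧ ∃ i ∈ I, a = blowPt i := by
  have h1 : b * qForm I ⟨2, a⟩ = 0 := congrArg Complex.re h
  have h2 : 1 * rForm I ⟨2, a⟩ = 0 := congrArg Complex.im h
  have hS : (⟨2, a⟩ : ℂ) ≠ 0 := fun h => by simpa using congrArg Complex.re h
  obtain ⟨i, hi, h3⟩ := exists_factor_eq_zero (by rwa [one_mul] at h2)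
  exact ⟨(mul_eq_zero.1 h1).resolve_right (qForm_pos I hS).ne', i, hi, by simp only at h3; linarith⟩

/-- Outside the next disc, the vector `levelVec` never vanishes: all points that are not yet resolved
are inside the next disc. -/
theorem levelVec_ne_zero {I : Finset ℕ} {n : ℕ} {z d : ℂ} {t : ℝ} (h : z = t * d) (hd : d ≠ 0)
    (hz : ‖z‖ ≤ 1) (hI : ∀ i ∈ I, n < i → 4 / 21 ≤ ‖z - 10 / 21‖) : levelVec I n z d ≠ 0 := by
  intro h0
  obtain ⟨i, hi, hin, h1, h2⟩ : ∃ i ∈ I, i ≠ n ∧ (nestMap n z).re = blowPt i ∧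
      (nestMap n z).im = 0 := by
    by_cases hn : n ∈ I
    · rw [levelVec, if_pos hn] at h0
      have h1 := congrArg Complex.re h0
      have h2 := congrArg Complex.im h0
      simp only [Complex.zero_re, Complex.zero_im] at h1 h2
      have hS : (⟨2, (nestMap n z).re⟩ : ℂ) ≠ 0 := fun h => by simpa using congrArg Complex.re h
      have hc : ((4 : ℝ) / 21) ^ n ≠ 0 := pow_ne_zero _ (by norm_num)
      have hc' : (-(4 : ℝ) / 21) ^ n ≠ 0 := pow_ne_zero _ (by norm_num)
      have h3 : d.im = 0 :=
        (mul_eq_zero.1 ((mul_eq_zero.1 h1).resolve_right (qForm_pos I hS).ne')).resolve_left hc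
      have h4 : d.re ≠ 0 := fun h4 => hd (Complex.ext h4 h3)
      have h5 := (mul_eq_zero.1 ((mul_eq_zero.1 h2).resolve_left
        (mul_ne_zero hc' h4))).resolve_left two_ne_zero
      obtain ⟨i, hi, h6⟩ := Finset.prod_eq_zero_iff.1 h5
      refine ⟨i, Finset.mem_of_mem_erase hi, Finset.ne_of_mem_erase hi, by linarith, ?_⟩
      simp [nestMap, h, h3]
    · rw [levelVec, if_neg hn] at h0
      obtain ⟨h1, i, hi, h2⟩ := eq_blowPt_of_blowVec_eq_zero h0
      exact ⟨i, hi, fun e => hn (e ▸ hi), h2, h1⟩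
  obtain ⟨h3, h4⟩ := near_of_nestMap_eq_blowPt hz hin h1 h2
  exact absurd (hI i hi h3) (not_le.2 h4)

theorem prod_erase_ne_zero (I : Finset ℕ) (n : ℕ) :
    ∏ i ∈ I.erase n, (2 * (nestMap n 0).re - blowPt i * 2) ≠ 0 := by
  refine Finset.prod_ne_zero_iff.2 fun i hi h => Finset.ne_of_mem_erase hi (blowPt_injective ?_)
  simp [nestMap] at h
  linarith

/-- At the blown-up point `blowPt n`, the coordinate that resolves it determines the direction. -/
theorem lineDir_eq_of_levelVec_zero {I : Finset ℕ} {n : ℕ} (hn : n ∈ I) {d e : ℂ} (hd : d ≠ 0)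
    (he : e ≠ 0) (hd' : levelVec I n 0 d ≠ 0) (he' : levelVec I n 0 e ≠ 0)
    (h : lineDir (levelVec I n 0 d) = lineDir (levelVec I n 0 e)) : lineDir d = lineDir e := by
  rw [lineDir_eq_iff hd' he'] at h
  rw [lineDir_eq_iff hd he]
  simp only [levelVec, if_pos hn] at h
  have hS : (⟨2, (nestMap n 0).re⟩ : ℂ) ≠ 0 := fun h => by simpa using congrArg Complex.re h
  have h1 := mul_ne_zero (mul_ne_zero (pow_ne_zero n (show (4 / 21 : ℝ) ≠ 0 by norm_num))
    (qForm_pos I hS).ne') (mul_ne_zero (pow_ne_zero n (show (-4 / 21 : ℝ) ≠ 0 by norm_num))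
      (mul_ne_zero two_ne_zero (prod_erase_ne_zero I n)))
  exact mul_left_cancel₀ h1 (by linear_combination -h)

/-- At the blown-up point `blowPt n`, the coordinate that resolves it takes all values. -/
theorem exists_levelVec_zero_eq {I : Finset ℕ} {n : ℕ} (hn : n ∈ I) (w : ℂ) :
    ∃ d, levelVec I n 0 d = w := by
  have hS : (⟨2, (nestMap n 0).re⟩ : ℂ) ≠ 0 := fun h => by simpa using congrArg Complex.re h
  have h1 := (qForm_pos I hS).ne'
  have h2 := prod_erase_ne_zero I n
  have h3 := pow_ne_zero n (show (4 / 21 : ℝ) ≠ 0 by norm_num)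
  have h4 := pow_ne_zero n (show (-4 / 21 : ℝ) ≠ 0 by norm_num)
  refine ⟨⟨w.im / ((-4 / 21) ^ n * (2 * ∏ i ∈ I.erase n, (2 * (nestMap n 0).re - blowPt i * 2))),
    w.re / ((4 / 21) ^ n * qForm I ⟨2, (nestMap n 0).re⟩)⟩, ?_⟩
  rw [levelVec, if_pos hn]
  apply Complex.ext
  · simp only; rw [mul_right_comm, mul_div_cancel₀ _ (mul_ne_zero h3 h1)]
  · simp only; rw [mul_right_comm, mul_div_cancel₀ _ (mul_ne_zero h4 (mul_ne_zero two_ne_zero h2))]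

/-! ### The map of the chain of projective planes to the torus -/

/-- The indices `0, …, m - 1` are distributed among two sets of odd cardinality. -/
structure IsOddSplitting (m : ℕ) (I J : Finset ℕ) : Prop where
  disjoint : Disjoint I J
  odd_left : Odd I.card
  odd_right : Odd J.card
  mem_or_mem_iff : ∀ n, n ∈ I ∨ n ∈ J ↔ n < m

/-- This is where the parity of the genus enters. -/
theorem exists_isOddSplitting {m : ℕ} (hm : Even m) (h0 : 0 < m) :
    ∃ I J, IsOddSplitting m I J := by
  refine ⟨{0}, Finset.Ico 1 m, by simp, by simp, ?_, fun n => ?_⟩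
  · rw [Nat.card_Ico]
    exact Nat.Even.sub_odd h0 hm odd_one
  · simp; omega

/-- The point of the torus over the point `[z₀ S : z₁]` of the projective plane, where this is not
one of the blown-up points with indices in `I` and `J`. -/
noncomputable def planePt (I J : Finset ℕ) (S : ℂ) (z₀ z₁ : ℝ) : ThreeTorus :=
  (lineDir S, lineDir (blowVec I S z₀ z₁), lineDir (blowVec J S z₀ z₁))

/-- The point of the torus over the point `nestMap n z` of the affine plane, at the direction of `d`
in case `z = 0`. -/
noncomputable def levelPt (I J : Finset ℕ) (n : ℕ) (z d : ℂ) : ThreeTorus :=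
  (lineDir ⟨2, (nestMap n z).re⟩, lineDir (levelVec I n z d), lineDir (levelVec J n z d))

theorem liesOver_planePt (I J : Finset ℕ) {S : ℂ} {z₀ z₁ : ℝ} (hS : S ≠ 0)
    (hz : z₀ ≠ 0 ∨ z₁ ≠ 0) : LiesOver I J (planePt I J S z₀ z₁) S z₀ z₁ :=
  ⟨hS, hz, onLine_lineDir _, onLine_lineDir _, onLine_lineDir _⟩

theorem liesOver_levelPt (I J : Finset ℕ) (n : ℕ) {z d : ℂ} {t : ℝ} (h : z = t * d) :
    LiesOver I J (levelPt I J n z d) ⟨2, (nestMap n z).re⟩ 1 (nestMap n z).im :=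
  ⟨fun h => by simpa using congrArg Complex.re h, Or.inl one_ne_zero, onLine_lineDir _,
    onLine_levelVec h, onLine_levelVec h⟩

theorem LiesOver.eq_planePt {I J : Finset ℕ} {x : ThreeTorus} {S : ℂ} {z₀ z₁ : ℝ}
    (h : LiesOver I J x S z₀ z₁) (hI : blowVec I S z₀ z₁ ≠ 0) (hJ : blowVec J S z₀ z₁ ≠ 0) :
    x = planePt I J S z₀ z₁ :=
  Prod.ext (h.dir.eq_lineDir h.ne) (Prod.ext (h.dirI.eq_lineDir hI) (h.dirJ.eq_lineDir hJ))

theorem LiesOver.mul {I J : Finset ℕ} {x : ThreeTorus} {S : ℂ} {z₀ z₁ : ℝ}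
    (h : LiesOver I J x S z₀ z₁) {b : ℝ} (hb : b ≠ 0) : LiesOver I J x S (b * z₀) (b * z₁) where
  ne := h.ne
  ne' := h.ne'.imp (mul_ne_zero hb) (mul_ne_zero hb)
  dir := h.dir
  dirI := by rw [blowVec_mul]; exact h.dirI.real_smul b
  dirJ := by rw [blowVec_mul]; exact h.dirJ.real_smul b

theorem planePt_smul {I J : Finset ℕ} (hI : Odd I.card) (hJ : Odd J.card) {a : ℝ} (ha : a ≠ 0)
    (S : ℂ) (z₀ z₁ : ℝ) : planePt I J (a * S) z₀ (a * z₁) = planePt I J S z₀ z₁ := by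
  simp only [planePt, blowVec_smul hI, blowVec_smul hJ, lineDir_real_mul ha,
    lineDir_real_mul (pow_ne_zero _ ha)]

theorem planePt_mul (I J : Finset ℕ) {b : ℝ} (hb : b ≠ 0) (S : ℂ) (z₀ z₁ : ℝ) :
    planePt I J S (b * z₀) (b * z₁) = planePt I J S z₀ z₁ := by
  simp only [planePt, blowVec_mul, lineDir_real_mul hb]

/-- The map of the copy number `0` to the torus, in homogeneous coordinates: the inversion
`discB z ↦ discA (z / ‖z‖ ^ 2)`, under which the line at infinity `v 0 = 0` becomes the exceptional
curve over the center `[0 : 0 : 1]` of the disc `A`. -/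
noncomputable def firstPt (I J : Finset ℕ) (v : Fin 3 → ℝ) : ThreeTorus :=
  planePt I J ⟨v 1, v 2⟩ (v 0) (4 * (v 1 ^ 2 + v 2 ^ 2))

/-- The map of the copy number `1` to the torus, in homogeneous coordinates: it lies over the
identity of the projective plane. -/
noncomputable def secondPt (I J : Finset ℕ) (v : Fin 3 → ℝ) : ThreeTorus :=
  planePt I J ⟨v 0, v 1⟩ 1 (v 2)

/-- The maps of the copies of the projective plane to the torus. The copy number `n + 2` is mapped
to the disc `nestMap n '' closedBall 0 1`, blown up at its center `blowPt n`. -/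
noncomputable def chainMap (T : ℕ → ℂ → ℂ) (I J : Finset ℕ) : ℕ → ProjectivePlane → ThreeTorus
  | 0, p => firstPt I J p.coords
  | 1, p => secondPt I J p.coords
  | n + 2, p => levelPt I J n (p.blowDown (T n)) (p.blowDir (T n))

section
variable {m : ℕ} {I J : Finset ℕ} {T : ℕ → ℂ → ℂ}

namespace IsOddSplitting

theorem lt_left (hs : IsOddSplitting m I J) {i : ℕ} (h : i ∈ I) : i < m :=
  (hs.mem_or_mem_iff i).1 (Or.inl h)

theorem lt_right (hs : IsOddSplitting m I J) {i : ℕ} (h : i ∈ J) : i < m :=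
  (hs.mem_or_mem_iff i).1 (Or.inr h)

theorem firstPt_smul (hs : IsOddSplitting m I J) {a : ℝ} (ha : a ≠ 0) (v : Fin 3 → ℝ) :
    firstPt I J (a • v) = firstPt I J v := by
  have e : (⟨a * v 1, a * v 2⟩ : ℂ) = a * ⟨v 1, v 2⟩ := by
    apply Complex.ext
    · rw [Complex.re_ofReal_mul]
    · rw [Complex.im_ofReal_mul]
  simp only [firstPt, Pi.smul_apply, smul_eq_mul]
  rw [e, show 4 * ((a * v 1) ^ 2 + (a * v 2) ^ 2) = a * (a * (4 * (v 1 ^ 2 + v 2 ^ 2))) by ring,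
    planePt_smul hs.odd_left hs.odd_right ha, planePt_mul _ _ ha]

theorem secondPt_smul (hs : IsOddSplitting m I J) {a : ℝ} (ha : a ≠ 0) (v : Fin 3 → ℝ) :
    secondPt I J (a • v) = secondPt I J v := by
  have e : (⟨a * v 0, a * v 1⟩ : ℂ) = a * ⟨v 0, v 1⟩ := by
    apply Complex.ext
    · rw [Complex.re_ofReal_mul]
    · rw [Complex.im_ofReal_mul]
  simp only [secondPt, Pi.smul_apply, smul_eq_mul]
  rw [e, planePt_smul hs.odd_left hs.odd_right ha]

theorem chainMap_zero_mk (hs : IsOddSplitting m I J) (T : ℕ → ℂ → ℂ) {v : Fin 3 → ℝ}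
    (hv : v ≠ 0) : chainMap T I J 0 (.mk v hv) = firstPt I J v := by
  obtain ⟨a, ha, h⟩ := ProjectivePlane.exists_coords_mk v hv
  rw [chainMap, h, hs.firstPt_smul ha]

theorem chainMap_one_mk (hs : IsOddSplitting m I J) (T : ℕ → ℂ → ℂ) {v : Fin 3 → ℝ}
    (hv : v ≠ 0) : chainMap T I J 1 (.mk v hv) = secondPt I J v := by
  obtain ⟨a, ha, h⟩ := ProjectivePlane.exists_coords_mk v hv
  rw [chainMap, h, hs.secondPt_smul ha]

end IsOddSplitting

open ProjectivePlane in
theorem normSq_pos_of_formB {v : Fin 3 → ℝ} (hv : v ≠ 0) (hB : 0 ≤ formB v) :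
    0 < v 1 ^ 2 + v 2 ^ 2 := by
  by_contra! h
  have h1 : v 1 = 0 := by nlinarith [sq_nonneg (v 1), sq_nonneg (v 2)]
  have h2 : v 2 = 0 := by nlinarith [sq_nonneg (v 1), sq_nonneg (v 2)]
  have h0 : v 0 = 0 := by
    simp only [formB, h1, h2] at hB; nlinarith [sq_nonneg (v 0)]
  exact hv (by ext i; fin_cases i <;> simp [h0, h1, h2])

open ProjectivePlane in
theorem normSq_pos_of_formA {v : Fin 3 → ℝ} (hv : v ≠ 0) (hA : 0 ≤ formA v) :
    0 < v 0 ^ 2 + v 1 ^ 2 := by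
  by_contra! h
  have h1 : v 0 = 0 := by nlinarith [sq_nonneg (v 0), sq_nonneg (v 1)]
  have h2 : v 1 = 0 := by nlinarith [sq_nonneg (v 0), sq_nonneg (v 1)]
  have h0 : v 2 = 0 := by
    simp only [formA, h1, h2] at hA; nlinarith [sq_nonneg (v 2)]
  exact hv (by ext i; fin_cases i <;> simp [h0, h1, h2])

theorem mk_complex_ne_zero {a b : ℝ} (h : 0 < a ^ 2 + b ^ 2) : (⟨a, b⟩ : ℂ) ≠ 0 := fun e => by
  have h1 : a = 0 := congrArg Complex.re e
  have h2 : b = 0 := congrArg Complex.im e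
  simp [h1, h2] at h

open ProjectivePlane in
theorem liesOver_firstPt (I J : Finset ℕ) {v : Fin 3 → ℝ} (hv : v ≠ 0) (hB : 0 ≤ formB v) :
    LiesOver I J (firstPt I J v) ⟨v 1, v 2⟩ (v 0) (4 * (v 1 ^ 2 + v 2 ^ 2)) :=
  have h := normSq_pos_of_formB hv hB
  liesOver_planePt I J (mk_complex_ne_zero h) (Or.inr (by positivity))

open ProjectivePlane in
theorem liesOver_secondPt (I J : Finset ℕ) {v : Fin 3 → ℝ} (hv : v ≠ 0) (hA : 0 ≤ formA v) :
    LiesOver I J (secondPt I J v) ⟨v 0, v 1⟩ 1 (v 2) :=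
  liesOver_planePt I J (mk_complex_ne_zero (normSq_pos_of_formA hv hA)) (Or.inl one_ne_zero)

open ProjectivePlane in
theorem exists_blowDown_eq_mul {T : ℂ → ℂ} (hT : IsTwist T) (p : ProjectivePlane) :
    ∃ t : ℝ, blowDown T p = t * blowDir T p := by
  by_cases h : blowDown T p = 0
  · exact ⟨0, by simp [h]⟩
  · exact ⟨1, by simp [blowDown_eq_blowDir hT p h]⟩

theorem blowVec_first_ne_zero (I : Finset ℕ) {S : ℂ} (hS : S ≠ 0) (z₀ : ℝ) {z₁ : ℝ}
    (hz : z₁ ≠ 0) : blowVec I S z₀ z₁ ≠ 0 := fun h =>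
  mul_ne_zero hz (qForm_pos I hS).ne' (congrArg Complex.re h)

theorem blowPt_mem_Ico (n : ℕ) : 0 ≤ blowPt n ∧ blowPt n < 1 := by
  have h : |(-4 / 21 : ℝ) ^ n| ≤ 1 := by
    rw [abs_pow]; exact pow_le_one₀ (abs_nonneg _) (by rw [abs_of_neg] <;> norm_num)
  have := abs_le.1 h
  unfold blowPt
  constructor <;> linarith [this.1, this.2]

open ProjectivePlane in
/-- All points blown up in `blowVec` are inside the disc `B`. -/
theorem blowVec_second_ne_zero (I : Finset ℕ) {v : Fin 3 → ℝ} (hv : v ≠ 0) (hA : 0 ≤ formA v)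
    (hB : 0 ≤ formB v) : blowVec I ⟨v 0, v 1⟩ 1 (v 2) ≠ 0 := by
  intro h
  have hS := mk_complex_ne_zero (normSq_pos_of_formA hv hA)
  have h1 : v 2 * qForm I ⟨v 0, v 1⟩ = 0 := congrArg Complex.re h
  have h2 : 1 * rForm I ⟨v 0, v 1⟩ = 0 := congrArg Complex.im h
  have h3 := (mul_eq_zero.1 h1).resolve_right (qForm_pos I hS).ne'
  obtain ⟨i, -, h4⟩ := exists_factor_eq_zero (by rwa [one_mul] at h2)
  have h5 : v 0 ≠ 0 := re_ne_zero_of_factor hS h4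
  simp only at h4
  obtain ⟨h6, h7⟩ := blowPt_mem_Ico i
  have h8 : 0 < v 0 ^ 2 := by positivity
  have h9 : formB v = (blowPt i ^ 2 - 1) * v 0 ^ 2 := by
    rw [formB, h3]; linear_combination (2 * v 1 + blowPt i * v 0) * h4
  have : blowPt i ^ 2 < 1 := by nlinarith
  nlinarith

theorem continuousAt_planePt (I J : Finset ℕ) {X : Type*} [TopologicalSpace X] {S : X → ℂ}
    {f g : X → ℝ} (hS : Continuous S) (hf : Continuous f) (hg : Continuous g) {x : X}
    (h1 : S x ≠ 0) (h2 : blowVec I (S x) (f x) (g x) ≠ 0) (h3 : blowVec J (S x) (f x) (g x) ≠ 0) :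
    ContinuousAt (fun x => planePt I J (S x) (f x) (g x)) x :=
  ((continuousAt_lineDir h1).comp hS.continuousAt).prodMk
    (((continuousAt_lineDir h2).comp (f := fun x => blowVec I (S x) (f x) (g x))
      (continuous_blowVec I hS hf hg).continuousAt).prodMk
    ((continuousAt_lineDir h3).comp (f := fun x => blowVec J (S x) (f x) (g x))
      (continuous_blowVec J hS hf hg).continuousAt))

theorem levelPt_mul (I J : Finset ℕ) (n : ℕ) (z d : ℂ) (a : ℝ) (ha : a ≠ 0) :
    levelPt I J n z (a * d) = levelPt I J n z d := by
  simp only [levelPt, lineDir_levelVec_mul _ _ _ _ ha]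

open ProjectivePlane in
theorem levelVec_blowDir_ne_zero {n : ℕ} {T : ℂ → ℂ} (hT : IsTwist T) {K : Finset ℕ}
    (hK : ∀ i ∈ K, i < m) {v : Fin 3 → ℝ} (hv : v ≠ 0) (hA : 0 ≤ formA v)
    (hB : n + 1 < m → 0 ≤ formB v) :
    levelVec K n (blowDown T (.mk v hv)) (blowDir T (.mk v hv)) ≠ 0 := by
  obtain ⟨t, ht⟩ := exists_blowDown_eq_mul hT (.mk v hv)
  refine levelVec_ne_zero ht (blowDir_ne_zero hT hv hA) (norm_blowDown_le hT hv hA) fun i hi hn => ?_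
  rw [← not_lt, blowDown_sub_lt_iff hT hv hA, not_lt]
  exact hB (by have := hK i hi; omega)

open ProjectivePlane in
/-- The map is continuous on the part of each copy that belongs to the chain. -/
theorem continuousAt_chainMap (hs : IsOddSplitting m I J) (hT : ∀ n, IsTwist (T n)) (n : ℕ)
    {v : Fin 3 → ℝ} (hv : v ≠ 0) (hA : 0 < n → 0 ≤ formA v) (hB : n + 1 < m + 2 → 0 ≤ formB v) :
    ContinuousAt (chainMap T I J n) (.mk v hv) := by
  match n with
  | 0 =>
    refine continuousAt_of_coords (g' := firstPt I J) hv ?_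
      (Filter.Eventually.of_forall fun w hw => hs.chainMap_zero_mk T hw)
    have h := normSq_pos_of_formB hv (hB (by omega))
    have hS := mk_complex_ne_zero h
    have hz : 4 * (v 1 ^ 2 + v 2 ^ 2) ≠ 0 := by positivity
    exact continuousAt_planePt I J (continuous_mk_complex (by fun_prop) (by fun_prop))
      (by fun_prop) (by fun_prop) hS (blowVec_first_ne_zero I hS _ hz)
      (blowVec_first_ne_zero J hS _ hz)
  | 1 =>
    refine continuousAt_of_coords (g' := secondPt I J) hv ?_
      (Filter.Eventually.of_forall fun w hw => hs.chainMap_one_mk T hw)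
    obtain ⟨i, hi⟩ := Finset.card_pos.1 hs.odd_left.pos
    have hm := hs.lt_left hi
    have hA' := hA one_pos
    have hB' := hB (by omega)
    exact continuousAt_planePt I J (continuous_mk_complex (by fun_prop) (by fun_prop))
      (by fun_prop) (by fun_prop) (mk_complex_ne_zero (normSq_pos_of_formA hv hA'))
      (blowVec_second_ne_zero I hv hA' hB') (blowVec_second_ne_zero J hv hA' hB')
  | n + 2 =>
    have hA' := hA (by omega)
    have hB' : n + 1 < m → 0 ≤ formB v := fun h => hB (by omega)
    refine continuousAt_blowDown (hT n) (G := levelPt I J n) (levelPt_mul I J n) hv hA' ?_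
    have h1 : (⟨2, (nestMap n (blowDown (T n) (.mk v hv))).re⟩ : ℂ) ≠ 0 := fun h => by
      simpa using congrArg Complex.re h
    have h4 : Continuous fun x : ℂ × ℂ => (⟨2, (nestMap n x.1).re⟩ : ℂ) :=
      continuous_mk_complex continuous_const
        (Complex.continuous_re.comp ((continuous_nestMap n).comp continuous_fst))
    have key : ∀ K : Finset ℕ, (∀ i ∈ K, i < m) →
        ContinuousAt (fun x : ℂ × ℂ => lineDir (levelVec K n x.1 x.2))
          (blowDown (T n) (.mk v hv), blowDir (T n) (.mk v hv)) := fun K hK =>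
      ContinuousAt.comp (f := fun x : ℂ × ℂ => levelVec K n x.1 x.2)
        (continuousAt_lineDir (levelVec_blowDir_ne_zero (hT n) hK hv hA' hB'))
        (continuous_levelVec K n).continuousAt
    exact (ContinuousAt.comp (f := fun x : ℂ × ℂ => (⟨2, (nestMap n x.1).re⟩ : ℂ))
      (continuousAt_lineDir h1) h4.continuousAt).prodMk
      ((key I fun i => hs.lt_left).prodMk (key J fun i => hs.lt_right))

end

/-! ### Compatibility with the gluing -/

/-- Twists that make the maps of consecutive copies agree on the glued circles. -/
structure IsSeamTwist (T : ℕ → ℂ → ℂ) : Prop where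
  isTwist : ∀ n, IsTwist (T n)
  zero : ∀ z, ‖z‖ = 1 → (ProjectivePlane.discA z).blowDown (T 0) = z
  succ : ∀ n z, ‖z‖ = 1 → (ProjectivePlane.discA z).blowDown (T (n + 1)) = ProjectivePlane.seam z

theorem exists_isSeamTwist : ∃ T, IsSeamTwist T := by
  obtain ⟨T₀, h₀, h₀'⟩ := ProjectivePlane.exists_twist_id
  obtain ⟨T₁, h₁, h₁'⟩ := ProjectivePlane.exists_twist_seam
  refine ⟨fun n => n.casesOn T₀ fun _ => T₁, fun n => ?_, h₀', fun _ => h₁'⟩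
  cases n
  · exact h₀
  · exact h₁

section
variable {m : ℕ} {I J : Finset ℕ} {T : ℕ → ℂ → ℂ}
open ProjectivePlane

theorem levelPt_self (I J : Finset ℕ) (n : ℕ) (z : ℂ) :
    levelPt I J n z z = planePt I J ⟨2, (nestMap n z).re⟩ 1 (nestMap n z).im := by
  simp only [levelPt, levelVec_self, planePt]

theorem levelPt_blowDir_of_ne (I J : Finset ℕ) (n : ℕ) {T : ℂ → ℂ} (hT : IsTwist T)
    {p : ProjectivePlane} {z : ℂ} (hp : blowDown T p = z) (hz : z ≠ 0) :
    levelPt I J n (blowDown T p) (blowDir T p) =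
      planePt I J ⟨2, (nestMap n z).re⟩ 1 (nestMap n z).im := by
  rw [blowDown_eq_blowDir hT p (by rwa [hp]), hp, levelPt_self]

theorem ne_zero_of_norm_eq_one {z : ℂ} (hz : ‖z‖ = 1) : z ≠ 0 := by
  rintro rfl; simp at hz

theorem nestMap_one_ne_zero {u : ℂ} (hu : ‖u‖ = 1) : nestMap 1 u ≠ 0 := by
  intro h
  have := norm_nestMap_one_sub u
  rw [h, hu] at this
  norm_num at this

/-- The maps of consecutive copies agree on the glued circles. -/
theorem chainMap_discB (hs : IsOddSplitting m I J) (hT : IsSeamTwist T) (n : ℕ) {z : ℂ}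
    (hz : ‖z‖ = 1) : chainMap T I J n (discB z) = chainMap T I J (n + 1) (discA z) := by
  have h1 := re_sq_add_im_sq hz
  match n with
  | 0 =>
    rw [discB_eq _ (vec3_ne_zero_of_zero two_ne_zero), hs.chainMap_zero_mk,
      discA_eq _ (vec3_ne_zero_of_two two_ne_zero), hs.chainMap_one_mk]
    have h2 := planePt_mul I J (two_ne_zero (α := ℝ)) ⟨z.re, z.im⟩ 1 2
    simp only [firstPt, secondPt, Matrix.cons_val_zero, Matrix.cons_val_one, Matrix.cons_val]
    rw [h1, ← h2]
    norm_num
  | 1 =>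
    rw [discB_eq _ (vec3_ne_zero_of_zero two_ne_zero), hs.chainMap_one_mk, chainMap,
      levelPt_blowDir_of_ne I J 0 (hT.isTwist 0) (hT.zero z hz) (ne_zero_of_norm_eq_one hz),
      nestMap_zero]
    rfl
  | n + 2 =>
    rw [chainMap, chainMap,
      levelPt_blowDir_of_ne I J n (hT.isTwist n) (blowDown_discB (hT.isTwist n) hz)
        (nestMap_one_ne_zero (norm_seam hz)),
      levelPt_blowDir_of_ne I J (n + 1) (hT.isTwist (n + 1)) (hT.succ n z hz)
        (ne_zero_of_norm_eq_one (norm_seam hz)), nestMap_nestMap]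

/-- The disc number `k + 1` is in the first one, and touches its boundary only if `k = 0`. -/
theorem nestMap_succ_near {k : ℕ} {z : ℂ} (hz : ‖z‖ ≤ 1) :
    ‖nestMap (k + 1) z - 10 / 21‖ ≤ 4 / 21 ∧
      (4 / 21 ≤ ‖nestMap (k + 1) z - 10 / 21‖ → k = 0 ∧ ‖z‖ = 1) := by
  have key : ∀ k, ‖nestMap k z‖ ≤ 1 ∧ (0 < k → ‖nestMap k z‖ < 1) := by
    intro k
    induction k with
    | zero => rw [nestMap_zero]; exact ⟨hz, fun h => absurd h (lt_irrefl 0)⟩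
    | succ k ih =>
      have h1 : ‖nestMap 1 (nestMap k z) - 10 / 21‖ ≤ 4 / 21 := by
        rw [norm_nestMap_one_sub]; linarith [ih.1]
      rw [nestMap_nestMap, add_comm] at h1
      have := norm_lt_of_near h1
      exact ⟨by linarith, fun _ => by linarith⟩
  have h1 : ‖nestMap (k + 1) z - 10 / 21‖ = 4 / 21 * ‖nestMap k z‖ := by
    rw [← norm_nestMap_one_sub, nestMap_nestMap, add_comm]
  rw [h1]
  refine ⟨by linarith [(key k).1], fun h => ?_⟩
  have h2 : k = 0 := by
    by_contra hk
    linarith [(key k).2 (Nat.pos_of_ne_zero hk)]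
  subst h2
  rw [nestMap_zero] at h
  exact ⟨rfl, by linarith⟩

theorem norm_nestMap_lt {k : ℕ} {z : ℂ} (hz : ‖z‖ ≤ 1) : ‖nestMap (k + 1) z‖ < 1 := by
  linarith [norm_lt_of_near (nestMap_succ_near (k := k) hz).1]

theorem re_sq_add_im_sq_eq (z : ℂ) : z.re ^ 2 + z.im ^ 2 = ‖z‖ ^ 2 := by
  rw [← Complex.normSq_eq_norm_sq, Complex.normSq_apply]; ring

/-! ### Injectivity up to the gluing -/

section injective

variable {n : ℕ} {v w : Fin 3 → ℝ} {hv : v ≠ 0} {hw : w ≠ 0}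

/-- The copy number `n + 2` lies over the disc `nestMap n '' closedBall 0 1` of the affine plane. -/
theorem liesOver_chainMap (hT : IsTwist (T n)) {p : ProjectivePlane} :
    LiesOver I J (chainMap T I J (n + 2) p) ⟨2, (nestMap n (p.blowDown (T n))).re⟩ 1
      (nestMap n (p.blowDown (T n))).im := by
  obtain ⟨t, ht⟩ := exists_blowDown_eq_mul hT p
  exact liesOver_levelPt I J n ht

theorem complex_mk_eq_mul {a b c d t : ℝ} (h : (⟨a, b⟩ : ℂ) = t * ⟨c, d⟩) :
    a = t * c ∧ b = t * d := by
  have h1 := congrArg Complex.re h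
  have h2 := congrArg Complex.im h
  rw [Complex.re_ofReal_mul] at h1
  rw [Complex.im_ofReal_mul] at h2
  exact ⟨h1, h2⟩

/-- The copy number `0` is embedded. -/
theorem eq_of_first_first (hs : IsOddSplitting m I J) (hvB : 0 ≤ formB v) (hwB : 0 ≤ formB w)
    (h : firstPt I J v = firstPt I J w) : mk v hv = mk w hw := by
  obtain ⟨a, b, ha, hb, h1, h2, h3⟩ := (liesOver_firstPt I J hv hvB).unique hs.disjoint hs.odd_left
    hs.odd_right (h ▸ liesOver_firstPt I J hw hwB)
  obtain ⟨e1, e2⟩ := complex_mk_eq_mul h1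
  have hp := normSq_pos_of_formB hv hvB
  have e3 : a = b := by
    rw [e1, e2] at h3
    refine mul_right_cancel₀ (mul_ne_zero ha hp.ne') ?_
    linear_combination h3 / 4
  refine mk_eq_mk_iff.2 ⟨a, ha, ?_⟩
  ext i; fin_cases i
  · rw [e3]; exact h2
  · exact e1
  · exact e2

/-- The copy number `1` is embedded. -/
theorem eq_of_second_second (hs : IsOddSplitting m I J) (hvA : 0 ≤ formA v) (hwA : 0 ≤ formA w)
    (h : secondPt I J v = secondPt I J w) : mk v hv = mk w hw := by
  obtain ⟨a, b, ha, hb, h1, h2, h3⟩ := (liesOver_secondPt I J hv hvA).unique hs.disjoint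
    hs.odd_left hs.odd_right (h ▸ liesOver_secondPt I J hw hwA)
  obtain ⟨e1, e2⟩ := complex_mk_eq_mul h1
  rw [mul_one] at h2
  refine mk_eq_mk_iff.2 ⟨a, ha, ?_⟩
  ext i; fin_cases i
  · exact e1
  · exact e2
  · rw [← h2, one_mul] at h3; exact h3

/-- The copy number `0` lies over the closed disc `A`, and the copy number `1` over the complement of
the open disc `A`. -/
theorem glue_of_first_second (hs : IsOddSplitting m I J) (hvB : 0 ≤ formB v) (hwA : 0 ≤ formA w)
    (h : firstPt I J v = secondPt I J w) :
    ∃ z : ℂ, ‖z‖ = 1 ∧ mk v hv = discB z ∧ mk w hw = discA z := by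
  obtain ⟨a, b, ha, hb, h1, h2, h3⟩ := (liesOver_firstPt I J hv hvB).unique hs.disjoint
    hs.odd_left hs.odd_right (h ▸ liesOver_secondPt I J hw hwA)
  obtain ⟨e1, e2⟩ := complex_mk_eq_mul h1
  have hp := normSq_pos_of_formB hv hvB
  have hB : formB v = 0 := by
    refine le_antisymm ?_ hvB
    simp only [formA, formB] at hwA ⊢
    rw [h3, e1, e2] at hwA
    have h4 : 0 < a ^ 2 * b ^ 2 * (v 1 ^ 2 + v 2 ^ 2) := by positivity
    by_contra! h5
    have h6 : 0 < a ^ 2 * (v 1 ^ 2 + v 2 ^ 2) * (b ^ 2 * (4 * (v 1 ^ 2 + v 2 ^ 2) - v 0 ^ 2)) := by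
      positivity
    have h7 : b ^ 2 * v 0 ^ 2 = 1 := by rw [← mul_pow, ← h2, one_pow]
    nlinarith
  obtain ⟨z, hz, e⟩ := exists_discB_sphere hv hB
  refine ⟨z, hz, e, ?_⟩
  rw [discB_eq _ (vec3_ne_zero_of_zero two_ne_zero)] at e
  obtain ⟨c, hc, rfl⟩ := mk_eq_mk_iff.1 e.symm
  rw [discA_eq _ (vec3_ne_zero_of_two two_ne_zero)]
  simp at e1 e2 h2 h3
  refine (mk_eq_mk_iff.2 ⟨a * c, mul_ne_zero ha hc, ?_⟩).symm
  have h8 := re_sq_add_im_sq hz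
  ext i; fin_cases i
  · simp; linear_combination e1
  · simp; linear_combination e2
  · simp; linear_combination h3 + 4 * b * a * c ^ 2 * h8 - 2 * a * c * h2

/-- The copy number `0` lies over the closed disc `A` and the copy number `n + 2` over the closed disc
`B`, and these are disjoint. -/
theorem first_ne_level (hs : IsOddSplitting m I J) (hT : IsTwist (T n)) (hv : v ≠ 0) (hvB : 0 ≤ formB v)
    (hwA : 0 ≤ formA w) : firstPt I J v ≠ chainMap T I J (n + 2) (mk w hw) := by
  intro h
  obtain ⟨a, b, ha, hb, h1, h2, h3⟩ := (liesOver_firstPt I J hv hvB).unique hs.disjoint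
    hs.odd_left hs.odd_right (h ▸ liesOver_chainMap hT)
  obtain ⟨e1, e2⟩ := complex_mk_eq_mul h1
  have hn := norm_blowDown_le hT hw hwA
  set z := blowDown (T n) (mk w hw)
  have h4 : ‖nestMap n z‖ ≤ 1 := by
    cases n
    · rwa [nestMap_zero]
    · exact (norm_nestMap_lt hn).le
  have h5 := re_sq_add_im_sq_eq (nestMap n z)
  have h6 : ‖nestMap n z‖ ^ 2 ≤ 1 := pow_le_one₀ (norm_nonneg _) h4
  have h7 : b ^ 2 * v 0 ^ 2 = 1 := by rw [← mul_pow, ← h2, one_pow]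
  have h8 : 0 ≤ b ^ 2 * (4 * (v 1 ^ 2 + v 2 ^ 2) - v 0 ^ 2) := mul_nonneg (sq_nonneg b) hvB
  have h9 : 4 ≤ a ^ 2 * (v 1 ^ 2 + v 2 ^ 2) := by
    have : a ^ 2 * (v 1 ^ 2 + v 2 ^ 2) = 2 ^ 2 + (nestMap n z).re ^ 2 := by
      rw [e1, e2]; ring
    nlinarith [sq_nonneg (nestMap n z).re]
  have h10 : 4 * (a ^ 2 * (v 1 ^ 2 + v 2 ^ 2)) ≤ (nestMap n z).im ^ 2 := by
    have : (nestMap n z).im ^ 2 = 4 * (a ^ 2 * (v 1 ^ 2 + v 2 ^ 2)) *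
        (b ^ 2 * (4 * (v 1 ^ 2 + v 2 ^ 2))) := by rw [h3]; ring
    rw [this]
    nlinarith
  nlinarith [sq_nonneg (nestMap n z).re]

/-- The copy number `1` lies over the complement of the disc `B`, and the copy number `n + 2` over
the closed disc `B`. Only for `n = 0` the latter contains boundary points. -/
theorem glue_of_second_level (hs : IsOddSplitting m I J) (hT : IsSeamTwist T) (hvA : 0 ≤ formA v)
    (hvB : 0 ≤ formB v) (hwA : 0 ≤ formA w)
    (h : secondPt I J v = chainMap T I J (n + 2) (mk w hw)) :
    n = 0 ∧ ∃ z : ℂ, ‖z‖ = 1 ∧ mk v hv = discB z ∧ mk w hw = discA z := by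
  obtain ⟨a, b, ha, hb, h1, h2, h3⟩ := (liesOver_secondPt I J hv hvA).unique hs.disjoint
    hs.odd_left hs.odd_right (h ▸ liesOver_chainMap (hT.isTwist n))
  obtain ⟨e1, e2⟩ := complex_mk_eq_mul h1
  have hn := norm_blowDown_le (hT.isTwist n) hw hwA
  have hone := norm_blowDown_eq_one_iff (hT.isTwist n) hw hwA
  obtain ⟨z, hz⟩ : ∃ z, z = blowDown (T n) (mk w hw) := ⟨_, rfl⟩
  rw [← hz] at e2 h3 hn hone
  rw [mul_one] at h2
  rw [← h2, one_mul] at h3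
  have h5 := re_sq_add_im_sq_eq (nestMap n z)
  have h6 : 1 ≤ ‖nestMap n z‖ ^ 2 := by
    have h7 : 0 ≤ a ^ 2 * formB v := mul_nonneg (sq_nonneg a) hvB
    rw [← h5, e2, h3]
    simp only [formB] at h7
    have : (a * v 0) ^ 2 = 4 := by rw [← e1]; norm_num
    nlinarith
  have h7 : 1 ≤ ‖nestMap n z‖ := by
    by_contra! h8
    nlinarith [norm_nonneg (nestMap n z)]
  obtain rfl : n = 0 := by
    cases n
    · rfl
    · exact absurd (norm_nestMap_lt hn) (not_lt.2 h7)
  refine ⟨rfl, z, ?_⟩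
  rw [nestMap_zero] at h7 e2 h3
  have hz1 : ‖z‖ = 1 := le_antisymm hn h7
  refine ⟨hz1, ?_, ?_⟩
  · rw [discB_eq _ (vec3_ne_zero_of_zero two_ne_zero)]
    refine mk_eq_mk_iff.2 ⟨a, ha, ?_⟩
    ext i; fin_cases i
    · exact e1
    · exact e2
    · exact h3
  · obtain ⟨y, hy, e⟩ := exists_discA_sphere hw (hone.1 hz1)
    rw [e, hT.zero y hy] at hz
    rw [e, hz]

/-- The image of a point determines the point of the affine plane that it lies over. -/
theorem nestMap_eq_of_level_level (hs : IsOddSplitting m I J) {k : ℕ} (hT : IsSeamTwist T)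
    {p q : ProjectivePlane} (h : chainMap T I J (n + 2) p = chainMap T I J (k + 2) q) :
    nestMap n (p.blowDown (T n)) = nestMap k (q.blowDown (T k)) := by
  obtain ⟨a, b, ha, hb, h1, h2, h3⟩ := (liesOver_chainMap (hT.isTwist n)).unique hs.disjoint
    hs.odd_left hs.odd_right (h ▸ liesOver_chainMap (hT.isTwist k))
  obtain ⟨e1, e2⟩ := complex_mk_eq_mul h1
  have e3 : a = 1 := by linarith
  rw [e3, one_mul] at e2
  rw [mul_one] at h2
  rw [← h2, e3, one_mul, one_mul] at h3
  exact Complex.ext e2.symm h3.symm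

/-- Each of the later copies is embedded: the coordinate that resolves the blown-up point separates
the points of the exceptional curve. -/
theorem eq_of_level_level (hs : IsOddSplitting m I J) (hn : n < m) (hT : IsSeamTwist T)
    (hvA : 0 ≤ formA v) (hvB : n + 1 < m → 0 ≤ formB v) (hwA : 0 ≤ formA w)
    (hwB : n + 1 < m → 0 ≤ formB w)
    (h : chainMap T I J (n + 2) (mk v hv) = chainMap T I J (n + 2) (mk w hw)) :
    mk v hv = mk w hw := by
  have hTn := hT.isTwist n
  have hz := nestMap_injective n (nestMap_eq_of_level_level hs hT h)
  refine eq_of_blowDown_eq hTn hv hw hvA hwA hz ?_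
  by_cases h0 : blowDown (T n) (mk v hv) = 0
  · have key : ∀ K : Finset ℕ, (∀ i ∈ K, i < m) → n ∈ K →
        lineDir (levelVec K n (blowDown (T n) (mk v hv)) (blowDir (T n) (mk v hv))) =
          lineDir (levelVec K n (blowDown (T n) (mk w hw)) (blowDir (T n) (mk w hw))) →
        lineDir (blowDir (T n) (mk v hv)) = lineDir (blowDir (T n) (mk w hw)) := by
      intro K hK hnK e
      have h1 := levelVec_blowDir_ne_zero hTn hK hv hvA hvB
      have h2 := levelVec_blowDir_ne_zero hTn hK hw hwA hwB
      rw [← hz, h0] at e h2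
      rw [h0] at h1
      exact lineDir_eq_of_levelVec_zero hnK (blowDir_ne_zero hTn hv hvA)
        (blowDir_ne_zero hTn hw hwA) h1 h2 e
    rcases (hs.mem_or_mem_iff n).2 hn with hK | hK
    · exact key I (fun i => hs.lt_left) hK (congrArg (fun x : ThreeTorus => x.2.1) h)
    · exact key J (fun i => hs.lt_right) hK (congrArg (fun x : ThreeTorus => x.2.2) h)
  · rw [blowDown_eq_blowDir hTn _ h0, blowDown_eq_blowDir hTn _ (hz ▸ h0), hz]

/-- The images of two of the later copies meet only if the copies are consecutive, and then only over
the common boundary of their annuli. -/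
theorem glue_of_level_level (hs : IsOddSplitting m I J) {k : ℕ} (hT : IsSeamTwist T)
    (hvA : 0 ≤ formA v) (hvB : 0 ≤ formB v) (hwA : 0 ≤ formA w)
    (h : chainMap T I J (n + 2) (mk v hv) = chainMap T I J (n + (k + 1) + 2) (mk w hw)) :
    k = 0 ∧ ∃ z : ℂ, ‖z‖ = 1 ∧ mk v hv = discB z ∧ mk w hw = discA z := by
  have e1 := nestMap_eq_of_level_level hs hT h
  rw [← nestMap_nestMap] at e1
  have hz := nestMap_injective n e1
  have hle := norm_blowDown_le (hT.isTwist (n + (k + 1))) hw hwA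
  have h1 := nestMap_succ_near (k := k) hle
  have h2 := blowDown_sub_le_iff (hT.isTwist n) hv hvA
  have h3 := blowDown_sub_lt_iff (hT.isTwist n) hv hvA
  rw [hz] at h2 h3
  have hB : formB v = 0 := le_antisymm (h2.1 h1.1) hvB
  obtain ⟨rfl, hone⟩ := h1.2 (not_lt.1 fun h => not_le.2 (h3.1 h) hvB)
  refine ⟨rfl, ?_⟩
  obtain ⟨y, hy, ey⟩ := exists_discB_sphere hv hB
  obtain ⟨y', hy', ey'⟩ := exists_discA_sphere hw
    ((norm_blowDown_eq_one_iff (hT.isTwist (n + 1)) hw hwA).1 hone)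
  rw [ey, ey', blowDown_discB (hT.isTwist n) hy, hT.succ n y' hy'] at hz
  have := seam_injOn hy hy' (nestMap_injective _ hz)
  exact ⟨y, hy, ey, this ▸ ey'⟩

/-- Points of the chain with the same image in the torus are equal or glued. -/
theorem eq_or_glue_of_chainMap_eq (hs : IsOddSplitting m I J) (hT : IsSeamTwist T) {i j : ℕ}
    (hij : i ≤ j) (hj : j < m + 2) {v w : Fin 3 → ℝ} (hv : v ≠ 0) (hw : w ≠ 0)
    (hvA : 0 < i → 0 ≤ formA v) (hvB : i + 1 < m + 2 → 0 ≤ formB v)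
    (hwA : 0 < j → 0 ≤ formA w) (hwB : j + 1 < m + 2 → 0 ≤ formB w)
    (h : chainMap T I J i (mk v hv) = chainMap T I J j (mk w hw)) :
    (i = j ∧ mk v hv = mk w hw) ∨
      (j = i + 1 ∧ ∃ z : ℂ, ‖z‖ = 1 ∧ mk v hv = discB z ∧ mk w hw = discA z) := by
  obtain ⟨l, hl⟩ := Finset.card_pos.1 hs.odd_left.pos
  have hm := hs.lt_left hl
  match i, j with
  | 0, 0 =>
    rw [hs.chainMap_zero_mk, hs.chainMap_zero_mk] at h
    exact Or.inl ⟨rfl, eq_of_first_first hs (hvB (by omega)) (hwB (by omega)) h⟩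
  | 0, 1 =>
    rw [hs.chainMap_zero_mk, hs.chainMap_one_mk] at h
    exact Or.inr ⟨rfl, glue_of_first_second hs (hvB (by omega)) (hwA one_pos) h⟩
  | 0, n + 2 =>
    rw [hs.chainMap_zero_mk] at h
    exact absurd h (first_ne_level hs (hT.isTwist n) hv (hvB (by omega)) (hwA (by omega)))
  | 1, 1 =>
    rw [hs.chainMap_one_mk, hs.chainMap_one_mk] at h
    exact Or.inl ⟨rfl, eq_of_second_second hs (hvA one_pos) (hwA one_pos) h⟩
  | 1, n + 2 =>
    rw [hs.chainMap_one_mk] at h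
    obtain ⟨rfl, h'⟩ := glue_of_second_level hs hT (hvA one_pos) (hvB (by omega))
      (hwA (by omega)) h
    exact Or.inr ⟨rfl, h'⟩
  | n + 2, k + 2 =>
    have hvA' := hvA (by omega)
    have hwA' := hwA (by omega)
    rcases Nat.eq_or_lt_of_le hij with e | e
    · obtain rfl : n = k := by omega
      exact Or.inl ⟨rfl, eq_of_level_level hs (by omega) hT hvA' (fun _ => hvB (by omega)) hwA'
        (fun _ => hwB (by omega)) h⟩
    · obtain ⟨l, rfl⟩ : ∃ l, k = n + (l + 1) := ⟨k - n - 1, by omega⟩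
      obtain ⟨rfl, h'⟩ := glue_of_level_level hs hT hvA' (hvB (by omega)) hwA' h
      exact Or.inr ⟨rfl, h'⟩

end injective

/-! ### Surjectivity onto the surface -/

/-- A point of the closed unit disc belongs to a difference of consecutive discs, the last disc
being counted as a whole. -/
theorem exists_nestMap_eq {m : ℕ} (hm : 0 < m) {w : ℂ} (hw : ‖w‖ ≤ 1) :
    ∃ n < m, ∃ z, ‖z‖ ≤ 1 ∧ nestMap n z = w ∧ (n + 1 < m → 4 / 21 ≤ ‖z - 10 / 21‖) := by
  suffices ∀ k n, n + k + 1 = m → ∀ z, ‖z‖ ≤ 1 → nestMap n z = w →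
      ∃ n < m, ∃ z, ‖z‖ ≤ 1 ∧ nestMap n z = w ∧ (n + 1 < m → 4 / 21 ≤ ‖z - 10 / 21‖) from
    this (m - 1) 0 (by omega) w hw (nestMap_zero w)
  intro k
  induction k with
  | zero => exact fun n hn z hz hzw => ⟨n, by omega, z, hz, hzw, fun h => by omega⟩
  | succ k ih =>
    intro n hn z hz hzw
    by_cases h : 4 / 21 ≤ ‖z - 10 / 21‖
    · exact ⟨n, by omega, z, hz, hzw, fun _ => h⟩
    · obtain ⟨y, hy, hy'⟩ := exists_nestMap_one_eq z
      exact ih (n + 1) (by omega) y (by linarith) (by rw [← nestMap_nestMap, hy, hzw])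

/-- The part of the surface over the disc `B` of the copy number `1`. -/
theorem LiesOver.exists_levelPt_eq (hs : IsOddSplitting m I J) {x : ThreeTorus} {w : ℂ}
    (h : LiesOver I J x ⟨2, w.re⟩ 1 w.im) (hw : ‖w‖ ≤ 1) :
    ∃ n < m, ∃ (z d : ℂ) (t : ℝ), ‖z‖ ≤ 1 ∧ (n + 1 < m → 4 / 21 ≤ ‖z - 10 / 21‖) ∧ d ≠ 0 ∧
      z = t * d ∧ levelPt I J n z d = x := by
  obtain ⟨l, hl⟩ := Finset.card_pos.1 hs.odd_left.pos
  obtain ⟨n, hn, z, hz, rfl, hz'⟩ := exists_nestMap_eq (hs.lt_left hl).pos hw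
  refine ⟨n, hn, z, ?_⟩
  have hlev : ∀ K : Finset ℕ, (∀ i ∈ K, i < m) → ∀ (d : ℂ) (t : ℝ), d ≠ 0 → z = t * d →
      levelVec K n z d ≠ 0 := fun K hK d t hd ht =>
    levelVec_ne_zero ht hd hz fun i hi hni => hz' (by have := hK i hi; omega)
  have hI := hlev I fun i => hs.lt_left
  have hJ := hlev J fun i => hs.lt_right
  by_cases h0 : z = 0
  · subst h0
    -- the coordinate that resolves `blowPt n` prescribes the direction
    have key : ∀ K : Finset ℕ, n ∈ K → ∀ t : Circle, ∃ d : ℂ, d ≠ 0 ∧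
        lineDir (levelVec K n 0 d) = t := by
      intro K hK t
      obtain ⟨u, hu, hu'⟩ := exists_lineDir_eq t
      obtain ⟨d, hd⟩ := exists_levelVec_zero_eq hK u
      refine ⟨d, ?_, by rw [hd, hu']⟩
      rintro rfl
      apply hu
      rw [← hd, levelVec, if_pos hK]
      apply Complex.ext <;> simp
    rcases (hs.mem_or_mem_iff n).2 hn with hK | hK
    · have hK' := Finset.disjoint_left.1 hs.disjoint hK
      obtain ⟨d, hd, e⟩ := key I hK x.2.1
      have h1 := hJ d 0 hd (by simp)
      refine ⟨d, 0, hz, hz', hd, by simp, Prod.ext (h.dir.eq_lineDir h.ne).symm (Prod.ext e ?_)⟩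
      simp only [levelPt, levelVec, if_neg hK'] at h1 ⊢
      exact (h.dirJ.eq_lineDir h1).symm
    · have hK' := Finset.disjoint_right.1 hs.disjoint hK
      obtain ⟨d, hd, e⟩ := key J hK x.2.2
      have h1 := hI d 0 hd (by simp)
      refine ⟨d, 0, hz, hz', hd, by simp, Prod.ext (h.dir.eq_lineDir h.ne).symm (Prod.ext ?_ e)⟩
      simp only [levelPt, levelVec, if_neg hK'] at h1 ⊢
      exact (h.dirI.eq_lineDir h1).symm
  · have h1 := hI z 1 h0 (by simp)
    have h2 := hJ z 1 h0 (by simp)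
    rw [levelVec_self] at h1 h2
    exact ⟨z, 1, hz, hz', h0, by simp, by rw [levelPt_self, h.eq_planePt h1 h2]⟩

/-- The images of the copies of the projective plane cover the surface. -/
theorem exists_chainMap_eq (hs : IsOddSplitting m I J) (hT : IsSeamTwist T) {x : ThreeTorus}
    (hx : x ∈ blowSurface I J) :
    ∃ n < m + 2, ∃ (v : Fin 3 → ℝ) (hv : v ≠ 0), (0 < n → 0 ≤ formA v) ∧
      (n + 1 < m + 2 → 0 ≤ formB v) ∧ chainMap T I J n (mk v hv) = x := by
  obtain ⟨S, z₀, z₁, h⟩ := hx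
  have hS : 0 < S.re ^ 2 + S.im ^ 2 := by
    have := Complex.normSq_pos.2 h.ne
    rw [Complex.normSq_apply] at this
    linarith
  -- over the closed disc `A` the copy number `0` is used, in the disc `B` the later copies, and the
  -- copy number `1` elsewhere
  by_cases hA : 4 * (z₀ ^ 2 * (S.re ^ 2 + S.im ^ 2)) ≤ z₁ ^ 2
  · have hz : z₁ ≠ 0 := by
      rintro rfl
      have h0 : z₀ ≠ 0 := h.ne'.resolve_right (not_not.2 rfl)
      have : 0 < 4 * (z₀ ^ 2 * (S.re ^ 2 + S.im ^ 2)) := by positivity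
      simp only [ne_eq, OfNat.ofNat_ne_zero, not_false_eq_true, zero_pow] at hA
      linarith
    obtain ⟨b, hb⟩ : ∃ b, b = 4 * (S.re ^ 2 + S.im ^ 2) / z₁ := ⟨_, rfl⟩
    have hb0 : b ≠ 0 := by rw [hb]; positivity
    have hbz : b * z₁ = 4 * (S.re ^ 2 + S.im ^ 2) := by rw [hb]; field_simp
    have hv : ![b * z₀, S.re, S.im] ≠ 0 := by
      intro e
      have e1 : S.re = 0 := congrFun e 1
      have e2 : S.im = 0 := congrFun e 2
      simp [e1, e2] at hS
    have h1 := h.mul hb0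
    have hbz0 : b * z₁ ≠ 0 := mul_ne_zero hb0 hz
    refine ⟨0, by omega, _, hv, fun h => absurd h (lt_irrefl _), fun _ => ?_, ?_⟩
    · simp only [formB, Matrix.cons_val_zero, Matrix.cons_val_one, Matrix.cons_val]
      have h2 : b ^ 2 * (4 * (z₀ ^ 2 * (S.re ^ 2 + S.im ^ 2))) ≤ b ^ 2 * z₁ ^ 2 :=
        mul_le_mul_of_nonneg_left hA (sq_nonneg b)
      rw [← mul_pow, hbz] at h2
      have h3 : (b * z₀) ^ 2 * (4 * (S.re ^ 2 + S.im ^ 2)) ≤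
          (4 * (S.re ^ 2 + S.im ^ 2)) * (4 * (S.re ^ 2 + S.im ^ 2)) := by linarith
      have := le_of_mul_le_mul_right h3 (by positivity)
      linarith
    · rw [hs.chainMap_zero_mk, h1.eq_planePt (blowVec_first_ne_zero I h.ne _ hbz0)
        (blowVec_first_ne_zero J h.ne _ hbz0)]
      simp only [firstPt, Matrix.cons_val_zero, Matrix.cons_val_one, Matrix.cons_val]
      rw [hbz]
  · have hz : z₀ ≠ 0 := by
      rintro rfl
      apply hA
      nlinarith [sq_nonneg z₁]
    have h1 := (h.rescale hs.odd_left hs.odd_right hz).mul (inv_ne_zero hz)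
    rw [inv_mul_cancel₀ hz, inv_mul_cancel_left₀ hz] at h1
    have e : (z₀ : ℂ) * S = ⟨z₀ * S.re, z₀ * S.im⟩ := by
      apply Complex.ext
      · rw [Complex.re_ofReal_mul]
      · rw [Complex.im_ofReal_mul]
    rw [e] at h1
    have hv : ![z₀ * S.re, z₀ * S.im, z₁] ≠ 0 := by
      intro e'
      apply h1.ne
      have e1 : z₀ * S.re = 0 := congrFun e' 0
      have e2 : z₀ * S.im = 0 := congrFun e' 1
      rw [e1, e2]; rfl
    have hvA : 0 ≤ formA ![z₀ * S.re, z₀ * S.im, z₁] := by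
      simp only [formA, Matrix.cons_val_zero, Matrix.cons_val_one, Matrix.cons_val]
      linarith
    by_cases hB : 0 ≤ formB ![z₀ * S.re, z₀ * S.im, z₁]
    · refine ⟨1, by omega, _, hv, fun _ => hvA, fun _ => hB, ?_⟩
      rw [hs.chainMap_one_mk]
      exact (h1.eq_planePt (blowVec_second_ne_zero I hv hvA hB)
        (blowVec_second_ne_zero J hv hvA hB)).symm
    · rw [not_le] at hB
      have h0 : z₀ * S.re ≠ 0 := formB_first_ne_zero hv hB.le
      obtain ⟨a, ha⟩ : ∃ a, a = 2 / (z₀ * S.re) := ⟨_, rfl⟩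
      have ha0 : a ≠ 0 := by rw [ha]; positivity
      have ha2 : a * (z₀ * S.re) = 2 := by rw [ha]; exact div_mul_cancel₀ _ h0
      have h2 := h1.rescale hs.odd_left hs.odd_right ha0
      have e' : (a : ℂ) * ⟨z₀ * S.re, z₀ * S.im⟩ = ⟨2, a * (z₀ * S.im)⟩ := by
        apply Complex.ext
        · rw [Complex.re_ofReal_mul, ha2]
        · rw [Complex.im_ofReal_mul]
      rw [e'] at h2
      have hw : ‖(⟨a * (z₀ * S.im), a * z₁⟩ : ℂ)‖ ≤ 1 := by
        rw [← sq_le_one_iff₀ (norm_nonneg _), ← re_sq_add_im_sq_eq]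
        simp only [formB, Matrix.cons_val_zero, Matrix.cons_val_one, Matrix.cons_val] at hB
        have h3 : (a * (z₀ * S.re)) ^ 2 = 4 := by rw [ha2]; norm_num
        have h4 := mul_neg_of_pos_of_neg (show 0 < a ^ 2 by positivity) hB
        linarith
      obtain ⟨n, hn, z, d, t, hz1, hz2, hd, ht, rfl⟩ :=
        LiesOver.exists_levelPt_eq hs (w := ⟨a * (z₀ * S.im), a * z₁⟩) h2 hw
      obtain ⟨u, hu, huA, huz, hud⟩ := exists_blowDown_eq (hT.isTwist n) hd hz1 ht
      refine ⟨n + 2, by omega, u, hu, fun _ => huA, fun hlt => ?_, ?_⟩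
      · rw [← not_lt, ← blowDown_sub_lt_iff (hT.isTwist n) hu huA, huz, not_lt]
        exact hz2 (by omega)
      · have hu0 := blowDir_ne_zero (hT.isTwist n) hu huA
        obtain ⟨c, hc⟩ := exists_real_mul_of_onLine (onLine_lineDir d)
          (hud ▸ onLine_lineDir (blowDir (T n) (mk u hu))) hd
        have hc0 : c ≠ 0 := by rintro rfl; exact hu0 (by simpa using hc)
        rw [chainMap, hc, levelPt_mul _ _ _ _ _ _ hc0, huz]

theorem chainMap_mem_blowSurface (hs : IsOddSplitting m I J) (hT : IsSeamTwist T) (n : ℕ)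
    {v : Fin 3 → ℝ} (hv : v ≠ 0) (hA : 0 < n → 0 ≤ formA v)
    (hB : n + 1 < m + 2 → 0 ≤ formB v) : chainMap T I J n (mk v hv) ∈ blowSurface I J := by
  match n with
  | 0 =>
    rw [hs.chainMap_zero_mk]
    exact ⟨_, _, _, liesOver_firstPt I J hv (hB (by omega))⟩
  | 1 =>
    rw [hs.chainMap_one_mk]
    exact ⟨_, _, _, liesOver_secondPt I J hv (hA one_pos)⟩
  | n + 2 => exact ⟨_, _, _, liesOver_chainMap (hT.isTwist n)⟩

end

/-! ### The embedding of the nonorientable surface -/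

open ProjectivePlane in
theorem PuncturedProjectivePlanes.form_coords {h : ℕ} (p : PuncturedProjectivePlanes h) :
    (0 < (p.1.1 : ℕ) → 0 ≤ formA p.1.2.coords) ∧
      ((p.1.1 : ℕ) + 1 < h → 0 ≤ formB p.1.2.coords) := by
  refine ⟨fun h0 => ?_, fun h0 => ?_⟩
  · rw [← not_lt, ← mk_mem_discA_ball (coords_ne_zero _), mk_coords]
    exact p.2.1 h0
  · rw [← not_lt, ← mk_mem_discB_ball (coords_ne_zero _), mk_coords]
    exact p.2.2 h0

section
variable {m : ℕ} {I J : Finset ℕ} {T : ℕ → ℂ → ℂ}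
open ProjectivePlane

/-- The map of the nonorientable surface to the torus. -/
noncomputable def surfaceMap (hs : IsOddSplitting m I J) (hT : IsSeamTwist T) :
    NonorientableSurface (m + 2) → ThreeTorus :=
  Quot.lift (fun p => chainMap T I J p.1.1 p.1.2) fun p q ⟨h, z, hz, hp, hq⟩ => by
    simp only [hp, hq, h]
    exact chainMap_discB hs hT _ hz

theorem continuous_surfaceMap (hs : IsOddSplitting m I J) (hT : IsSeamTwist T) :
    Continuous (surfaceMap hs hT) := by
  refine continuous_quot_lift _ (continuous_iff_continuousAt.2 fun p => ?_)
  have hp := p.form_coords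
  have h1 := continuousAt_chainMap hs hT.isTwist p.1.1 (coords_ne_zero p.1.2) hp.1 hp.2
  rw [ProjectivePlane.mk_coords] at h1
  have h2 : ContinuousAt (fun q : Fin (m + 2) × ProjectivePlane => chainMap T I J q.1 q.2) p.1 := by
    refine (h1.comp (f := Prod.snd) (x := p.1) continuous_snd.continuousAt).congr ?_
    have : ∀ᶠ q : Fin (m + 2) × ProjectivePlane in 𝓝 p.1, q.1 = p.1.1 :=
      continuous_fst.continuousAt.eventually (IsOpen.mem_nhds (isOpen_discrete {p.1.1}) rfl)
    filter_upwards [this] with q hq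
    rw [hq]; rfl
  exact h2.comp (f := Subtype.val) continuous_subtype_val.continuousAt

theorem injective_surfaceMap (hs : IsOddSplitting m I J) (hT : IsSeamTwist T) :
    Function.Injective (surfaceMap hs hT) := by
  have key : ∀ p q : PuncturedProjectivePlanes (m + 2), (p.1.1 : ℕ) ≤ q.1.1 →
      chainMap T I J p.1.1 p.1.2 = chainMap T I J q.1.1 q.1.2 →
      (Quot.mk PuncturedProjectivePlanes.Glue p) = Quot.mk _ q := by
    intro p q hpq h
    have hp := p.form_coords
    have hq := q.form_coords
    have := eq_or_glue_of_chainMap_eq hs hT hpq q.1.1.2 (coords_ne_zero p.1.2)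
      (coords_ne_zero q.1.2) hp.1 hp.2 hq.1 hq.2 (by rwa [mk_coords, mk_coords])
    rw [mk_coords, mk_coords] at this
    rcases this with ⟨h1, h2⟩ | h1
    · exact congrArg _ (Subtype.ext (Prod.ext (Fin.ext h1) h2))
    · exact Quot.sound h1
  rintro ⟨p⟩ ⟨q⟩ h
  rcases le_total (p.1.1 : ℕ) q.1.1 with hpq | hpq
  · exact key p q hpq h
  · exact (key q p hpq h.symm).symm

theorem range_surfaceMap (hs : IsOddSplitting m I J) (hT : IsSeamTwist T) :
    range (surfaceMap hs hT) = blowSurface I J := by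
  refine Subset.antisymm ?_ fun x hx => ?_
  · rintro _ ⟨⟨p⟩, rfl⟩
    have hp := p.form_coords
    have := chainMap_mem_blowSurface hs hT p.1.1 (coords_ne_zero p.1.2) hp.1 hp.2
    rwa [mk_coords] at this
  · obtain ⟨n, hn, v, hv, hA, hB, rfl⟩ := exists_chainMap_eq hs hT hx
    refine ⟨Quot.mk _ ⟨(⟨n, hn⟩, mk v hv), fun h => ?_, fun h => ?_⟩, rfl⟩
    · rw [mk_mem_discA_ball hv]; exact not_lt.2 (hA h)
    · rw [mk_mem_discB_ball hv]; exact not_lt.2 (hB h)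

end

theorem mainTheorem9 (h : ℕ) (h_even : Even h) (h_four : 4 ≤ h) :
    ∃ (_ : ChartedSpace (EuclideanSpace ℝ (Fin 2)) (NonorientableSurface h))
      (_ : IsManifold (𝓡 2) ∞ (NonorientableSurface h))
      (f : NonorientableSurface h → ThreeTorus),
      Manifold.IsSmoothEmbedding (𝓡 2) ((𝓡 1).prod ((𝓡 1).prod (𝓡 1))) ∞ f := by
  obtain ⟨m, rfl⟩ : ∃ m, h = m + 2 := ⟨h - 2, by omega⟩
  obtain ⟨I, J, hs⟩ := exists_isOddSplitting (m := m) (by simpa [Nat.even_add] using h_even)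
    (by omega)
  obtain ⟨T, hT⟩ := exists_isSeamTwist
  obtain ⟨c, hc, hf⟩ := exists_smooth_structure_of_range_eq hs.disjoint hs.odd_left hs.odd_right
    ((continuous_surfaceMap hs hT).isClosedEmbedding (injective_surfaceMap hs hT)).isEmbedding
    (range_surfaceMap hs hT)
  exact ⟨c, hc, _, hf⟩
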